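/- Let $d\in\mathbb N$ and let $\|\cdot\|$ be a norm on $\mathbb C^{d\times d}$. Let $A\in L^1_{\rm loc}(\mathbb R)^{d\times d}$ and let $\Phi$ be the fundamental matrix solution of $y'(x)=A(x)y(x)$, $x\in\mathbb R$, with $\Phi(0)=I_d$. (Solutions are locally absolutely continuous and satisfy the equation almost everywhere.) Assume that the propagator is exponentially bounded, $\sup_{|x-x'|\le 1}\|\Phi(x)\Phi(x')^{-1}\|<\infty$, and that the equation has an exponential dichotomy $Q\neq 0$ on $\mathbb R$; that is, $Q=Q^2\in\mathbb C^{d\times d}$ and there are constants $\varkappa,\varkappa'>0$ and $C,C'\ge 1$ with $$\|\Phi(x)Q\Phi(x')^{-1}\|\le Ce^{-\varkappa(x-x')}\ (x\ge x'),\qquad \|\Phi(x)(I_d-Q)\Phi(x')^{-1}\|\le C'e^{\varkappa'(x-x')}\ (x\le x').$$ Let $$\lambda_+(Q)=\limsup_{x\to\infty}\frac{\log\|\Phi(x)Q\|}{x}$$ be the upper Lyapunov exponent, and let $\varkappa'_+(Q)$ be the lower Bohl exponent on $\mathbb R_+=[0,\infty)$, i.e. the supremum of all $k\in\mathbb R$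 for which there is a $C(k)\geq 1$ such that $\|\Phi(x)Q\Phi(x')^{-1}\|\le C(k)e^{k(x-x')}$ for all $0\le x\le x'$. Let $\beta>0$ satisfy $\beta>\lambda_+(Q)-\varkappa'_+(Q)$. Then for every $R\in L^1(\mathbb R_+;e^{\beta x}dx)^{d\times d}$ the equation $y'(x)=(A(x)+R(x))y(x)$ has a unique matrix-valued Jost solution $Y_+$ on $\mathbb R_+$, that is, a unique $d\times d$ matrix-valued solution $Y_+$ on $[0,\infty)$ with $$\limsup_{x\to\infty}\frac{\log\|Y_+(x)-\Phi(x)Q\|}{x}<\varkappa'_+(Q)\qquad(\log 0=-\infty).$$ Moreover, the map $L^1(\mathbb R_+;e^{\beta x}dx)^{d\times d}\to\mathbb C^{d\times d}$, $R\mapsto Y_+(0)$, is continuous. -/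

import Mathlib

open MeasureTheory Filter Set
open scoped Matrix.Norms.L2Operator

namespace MatrixJost

noncomputable section

/-- Complex `d × d` matrices; the norm is the operator norm of the Euclidean norm on `ℂ^d`. -/
abbrev Mat (d : ℕ) : Type := Matrix (Fin d) (Fin d) ℂ

/-- `Y` is a (Carathéodory) solution of `Y' = B Y` on the interval `s`: it is locally absolutely
continuous on `s` and satisfies the equation at almost every point of `s`. -/
def IsSolutionOn {d : ℕ} (s : Set ℝ) (B Y : ℝ → Mat d) : Prop :=
  (∀ a ∈ s, ∀ b ∈ s, AbsolutelyContinuousOnInterval Y a b) ∧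
    ∀ᵐ x ∂(volume.restrict s), HasDerivWithinAt Y (B x * Y x) s x

/-- `Φ` is the fundamental matrix solution of `y' = A y` on `ℝ`, normalized at `0`. -/
def IsFundamentalSolution {d : ℕ} (A Φ : ℝ → Mat d) : Prop :=
  IsSolutionOn univ A Φ ∧ Φ 0 = 1

/-- The propagator `Φ(x) Φ(x')⁻¹` is exponentially bounded on `ℝ`. -/
def ExponentiallyBounded {d : ℕ} (Φ : ℝ → Mat d) : Prop :=
  ∃ C : ℝ, ∀ x x' : ℝ, |x - x'| ≤ 1 → ‖Φ x * (Φ x')⁻¹‖ ≤ C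

/-- The projection `Q` is an exponential dichotomy on `ℝ` for the equation with fundamental
solution `Φ`. -/
def IsExponentialDichotomy {d : ℕ} (Φ : ℝ → Mat d) (Q : Mat d) : Prop :=
  IsIdempotentElem Q ∧
    ∃ k k' C C' : ℝ, 0 < k ∧ 0 < k' ∧ 1 ≤ C ∧ 1 ≤ C' ∧
      (∀ x x' : ℝ, x' ≤ x → ‖Φ x * Q * (Φ x')⁻¹‖ ≤ C * Real.exp (-k * (x - x'))) ∧
      (∀ x x' : ℝ, x ≤ x' → ‖Φ x * (1 - Q) * (Φ x')⁻¹‖ ≤ C' * Real.exp (k' * (x - x')))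

/-- The lower Bohl exponent on `[0, ∞)` associated with `Q`: the supremum, in `[-∞, ∞]`, of all
real `k` such that `‖Φ(x) Q Φ(x')⁻¹‖ ≤ C(k) e^{k (x - x')}` for all `0 ≤ x ≤ x'`. -/
def lowerBohl {d : ℕ} (Φ : ℝ → Mat d) (Q : Mat d) : EReal :=
  sSup {e : EReal | ∃ k : ℝ, e = (k : EReal) ∧ ∃ C : ℝ, 1 ≤ C ∧
    ∀ x x' : ℝ, 0 ≤ x → x ≤ x' → ‖Φ x * Q * (Φ x')⁻¹‖ ≤ C * Real.exp (k * (x - x'))}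

/-- `limsup_{x → ∞} (log ‖F(x)‖) / x` in `[-∞, ∞]`, with `log 0 = -∞`. -/
def expRate {d : ℕ} (F : ℝ → Mat d) : EReal :=
  limsup (fun x : ℝ => ENNReal.log ‖F x‖ₑ / (x : EReal)) atTop

/-- The upper Lyapunov exponent on `[0, ∞)` associated with `Q`. -/
def upperLyapunov {d : ℕ} (Φ : ℝ → Mat d) (Q : Mat d) : EReal :=
  expRate (fun x => Φ x * Q)

/-- `Y` is a matrix-valued Jost solution on `[0, ∞)` of `y' = (A + R) y`, relative to the
fundamental solution `Φ` of `y' = A y` and the projection `Q`. -/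
def IsJostSolution {d : ℕ} (A Φ : ℝ → Mat d) (Q : Mat d) (R Y : ℝ → Mat d) : Prop :=
  IsSolutionOn (Ici 0) (fun x => A x + R x) Y ∧
    expRate (fun x => Y x - Φ x * Q) < lowerBohl Φ Q

/-- The measure `e^{β x} dx` on `[0, ∞)`. -/
def weightedMeasure (β : ℝ) : Measure ℝ :=
  (volume.restrict (Ici 0)).withDensity (fun x => ENNReal.ofReal (Real.exp (β * x)))

end

end MatrixJost

open MatrixJost

/-!
Jost solutions of `y' = (A + R) y` relative to an exponential dichotomy `Q` of `y' = A y`.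

Choose real numbers `k < lowerBohl Φ Q` and `l > upperLyapunov Φ Q` with `l - k ≤ β`; this is where
`β > λ₊(Q) - ϰ'₊(Q)` enters (`exists_rates`). Since `Q ≠ 0`, the lower Bohl exponent is at most `0`
(`lowerBohl_le_zero`), and exponential boundedness keeps it away from `-∞` (`lowerBohl_ne_bot`).
Hence the complementary part of the dichotomy obeys the bound with rate `k` as well, and the whole
propagator satisfies `‖Φ(x) Φ(t)⁻¹‖ ≤ C e^{k (x - t)}` for `0 ≤ x ≤ t`
(`exists_norm_propagator_le`).

A Jost solution is sought as `Y(x) = Φ(x) Q + e^{k x} V(x)` with `V` bounded. Variation of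
constants from infinity turns the differential equation into `Y(x) = Φ(x) Q - ∫_x^∞ Φ(x) Φ(t)⁻¹
R(t) Y(t) dt`, a Volterra equation for `V` whose kernel is bounded by `C ‖R(t)‖` and whose
inhomogeneity is bounded by `C C₂ ∫ e^{(l - k) t} ‖R(t)‖ dt < ∞`. Everything else rests on one
estimate: for an integrable `f ≥ 0` with tail `F(x) = ∫_x^∞ f`, the weight `e^{2F}` satisfies
`∫_x^∞ f e^{2F} ≤ e^{2F(x)} / 2` (`integral_mul_exp_tail_le`). It makes the Volterra operator a
contraction (`exists_volterra_solution`), and it yields the backward Grönwall inequality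
`le_of_le_add_integral_Ioi`, used three times: for the invertibility of `Φ` (a solution that
vanishes at `x ≥ 0` vanishes at `0`), for the uniqueness of Jost solutions, and for the continuous
dependence of `V`, hence of `Y(0) = Q + V(0)`, on `R`.

For uniqueness, the difference of two Jost solutions has a rate `k₁ < k < lowerBohl Φ Q`, with `k`
now depending on the two solutions, so that the boundary term `Φ(x) Φ(b)⁻¹ D(b)` in the variation of
constants formula tends to `0` as `b → ∞` (`IsSolutionOn.eq_zero_of_norm_le`).

Only the half-line `[0, ∞)` matters, so integrands are cut off there and the frame `Φ` is extended
constantly to the left of `0`; the Volterra theory can then be stated on all of `ℝ`.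
-/

namespace MatrixJost

open scoped Topology

/-! ### Absolutely continuous functions -/

theorem absolutelyContinuousOnInterval_of_dist_le {X Y : Type*} [PseudoMetricSpace X]
    [PseudoMetricSpace Y] {f : ℝ → X} {g : ℝ → Y} {a b K : ℝ}
    (hf : AbsolutelyContinuousOnInterval f a b)
    (h : ∀ x ∈ uIcc a b, ∀ y ∈ uIcc a b, dist (g x) (g y) ≤ K * dist (f x) (f y)) :
    AbsolutelyContinuousOnInterval g a b := by
  have h0 := Tendsto.const_mul K hf
  rw [mul_zero] at h0
  refine squeeze_zero' (Eventually.of_forall fun E => Finset.sum_nonneg fun i _ => dist_nonneg)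
    ?_ h0
  refine eventually_inf_principal.2 (Eventually.of_forall fun E hE => ?_)
  rw [Finset.mul_sum]
  exact Finset.sum_le_sum fun i hi => h _ (hE.1 i hi).1 _ (hE.1 i hi).2

theorem absolutelyContinuousOnInterval_congr {X : Type*} [PseudoMetricSpace X] {f g : ℝ → X}
    {a b : ℝ} (hf : AbsolutelyContinuousOnInterval f a b) (h : EqOn g f (uIcc a b)) :
    AbsolutelyContinuousOnInterval g a b :=
  absolutelyContinuousOnInterval_of_dist_le (K := 1) hf fun x hx y hy => by
    rw [h hx, h hy, one_mul]

/-- Products in a normed ring. Scalar multiplication lemmas that need `‖a • b‖ = ‖a‖ * ‖b‖` do not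
cover the operator norm of matrices. -/
theorem absolutelyContinuousOnInterval_mul {E : Type*} [NormedRing E] {f g : ℝ → E} {a b : ℝ}
    (hf : AbsolutelyContinuousOnInterval f a b) (hg : AbsolutelyContinuousOnInterval g a b) :
    AbsolutelyContinuousOnInterval (fun x => f x * g x) a b := by
  obtain ⟨K, hK⟩ := hf.exists_bound
  obtain ⟨L, hL⟩ := hg.exists_bound
  have h0 := (Tendsto.const_mul K hg).add (Tendsto.const_mul L hf)
  rw [mul_zero, mul_zero, add_zero] at h0
  refine squeeze_zero' (Eventually.of_forall fun E => Finset.sum_nonneg fun i _ => dist_nonneg)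
    (eventually_inf_principal.2 (Eventually.of_forall fun E hE => ?_)) h0
  rw [Finset.mul_sum, Finset.mul_sum, ← Finset.sum_add_distrib]
  refine Finset.sum_le_sum fun i hi => ?_
  obtain ⟨h1, h2⟩ := hE.1 i hi
  simp only [dist_eq_norm]
  have h : ∀ x y, f x * g x - f y * g y = f x * (g x - g y) + (f x - f y) * g y :=
    fun x y => by noncomm_ring
  rw [h, mul_comm L]
  exact (norm_add_le _ _).trans (add_le_add
    ((norm_mul_le _ _).trans (mul_le_mul_of_nonneg_right (hK _ h1) (norm_nonneg _)))
    ((norm_mul_le _ _).trans (mul_le_mul_of_nonneg_left (hL _ h2) (norm_nonneg _))))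

section Primitive

variable {F : Type*} [NormedAddCommGroup F] [NormedSpace ℝ F]

/-- The oscillation of a vector-valued primitive is dominated by that of the primitive of the norm,
which reduces the claim to real-valued functions. -/
theorem absolutelyContinuousOnInterval_primitive {g : ℝ → F} {a b c : ℝ}
    (hg : IntervalIntegrable g volume a b) (hc : c ∈ uIcc a b) :
    AbsolutelyContinuousOnInterval (fun x => ∫ t in c..x, g t) a b := by
  refine absolutelyContinuousOnInterval_of_dist_le (K := 1)
    (hg.norm.absolutelyContinuousOnInterval_intervalIntegral hc) fun x hx y hy => ?_
  have hi : ∀ {u v}, u ∈ uIcc a b → v ∈ uIcc a b → IntervalIntegrable g volume u v :=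
    fun hu hv => hg.mono_set (uIcc_subset_uIcc hu hv)
  rw [one_mul, dist_eq_norm, Real.dist_eq,
    intervalIntegral.integral_interval_sub_left (hi hc hx) (hi hc hy),
    intervalIntegral.integral_interval_sub_left (hi hc hx).norm (hi hc hy).norm]
  exact intervalIntegral.norm_integral_le_abs_integral_norm

/-- The fundamental theorem of calculus for absolutely continuous functions with values in a
Banach space. Differentiability almost everywhere is a hypothesis, since it is not automatic in
this generality. -/
theorem integral_eq_sub_of_absolutelyContinuousOnInterval [CompleteSpace F] {f g : ℝ → F}
    {a b : ℝ} (hf : AbsolutelyContinuousOnInterval f a b)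
    (hfg : ∀ᵐ x, x ∈ uIcc a b → HasDerivAt f (g x) x) (hg : IntervalIntegrable g volume a b) :
    ∫ x in a..b, g x = f b - f a := by
  obtain ⟨c, hc⟩ := (hf.sub (absolutelyContinuousOnInterval_primitive hg
    left_mem_uIcc)).const_of_ae_hasDerivAt_zero (by
      filter_upwards [hfg, hg.ae_hasDerivAt_integral] with x h1 h2 hx
      simpa using! (h1 hx).sub (h2 hx a left_mem_uIcc))
  have ha := hc a left_mem_uIcc
  have hb := hc b right_mem_uIcc
  simp only [Pi.sub_apply, intervalIntegral.integral_same, sub_zero] at ha hb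
  rw [ha, ← hb]; abel

theorem integral_Ioi_eq_sub_primitive {g : ℝ → F} (hg : Integrable g) (a x : ℝ) :
    ∫ t in Ioi x, g t = (∫ t in Ioi a, g t) - ∫ t in a..x, g t := by
  rw [← intervalIntegral.integral_Ioi_sub_Ioi' (hg.integrableOn (s := Ioi a))
    (hg.integrableOn (s := Ioi x)), sub_sub_cancel]

theorem continuous_integral_Ioi {g : ℝ → F} (hg : Integrable g) :
    Continuous fun x => ∫ t in Ioi x, g t := by
  rw [funext (integral_Ioi_eq_sub_primitive hg 0)]
  exact continuous_const.sub (intervalIntegral.continuous_primitive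
    (fun a b => hg.intervalIntegrable) 0)

theorem absolutelyContinuousOnInterval_integral_Ioi {g : ℝ → F} (hg : Integrable g) (a b : ℝ) :
    AbsolutelyContinuousOnInterval (fun x => ∫ t in Ioi x, g t) a b := by
  refine absolutelyContinuousOnInterval_of_dist_le (K := 1)
    (absolutelyContinuousOnInterval_primitive (hg.intervalIntegrable (a := a) (b := b))
      left_mem_uIcc) fun x _ y _ => ?_
  rw [integral_Ioi_eq_sub_primitive hg a x, integral_Ioi_eq_sub_primitive hg a y,
    dist_sub_left, one_mul]

theorem ae_hasDerivAt_integral_Ioi [CompleteSpace F] {g : ℝ → F} (hg : Integrable g) :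
    ∀ᵐ x, HasDerivAt (fun y => ∫ t in Ioi y, g t) (-g x) x := by
  have h := LocallyIntegrable.ae_hasDerivAt_integral hg.locallyIntegrable
  filter_upwards [h] with x hx
  rw [funext (integral_Ioi_eq_sub_primitive hg 0)]
  exact (hx 0).const_sub _

end Primitive

/-! ### Volterra equations that run backwards from infinity -/

section Volterra

variable {f : ℝ → ℝ}

theorem integral_Ioi_nonneg (hf0 : ∀ t, 0 ≤ f t) (x : ℝ) : 0 ≤ ∫ t in Ioi x, f t :=
  integral_nonneg hf0

theorem integral_Ioi_le_integral (hf : Integrable f) (hf0 : ∀ t, 0 ≤ f t) (x : ℝ) :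
    ∫ t in Ioi x, f t ≤ ∫ t, f t :=
  setIntegral_le_integral hf (Eventually.of_forall hf0)

theorem integrable_mul_exp_tail (hf : Integrable f) (hf0 : ∀ t, 0 ≤ f t) :
    Integrable fun t => f t * Real.exp (2 * ∫ s in Ioi t, f s) := by
  refine hf.mul_bdd (c := Real.exp (2 * ∫ s, f s)) ?_ (Eventually.of_forall fun t => ?_)
  · exact (Real.continuous_exp.comp
      (continuous_const.mul (continuous_integral_Ioi hf))).aestronglyMeasurable
  · rw [Real.norm_eq_abs, Real.abs_exp]
    exact Real.exp_le_exp.2 (mul_le_mul_of_nonneg_left (integral_Ioi_le_integral hf hf0 t)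
      zero_le_two)

/-- The weight `exp (2 ∫_x^∞ f)` turns the Volterra operator with density `f` into a contraction
with constant `1 / 2`. -/
theorem integral_mul_exp_tail_le (hf : Integrable f) (hf0 : ∀ t, 0 ≤ f t) (x : ℝ) :
    ∫ t in Ioi x, f t * Real.exp (2 * ∫ s in Ioi t, f s) ≤
      Real.exp (2 * ∫ s in Ioi x, f s) / 2 := by
  set F : ℝ → ℝ := fun t => ∫ s in Ioi t, f s with hF
  have hint := integrable_mul_exp_tail hf hf0
  -- `exp ∘ (2 F)` is absolutely continuous, since `F` takes its values in a compact interval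
  obtain ⟨K, hK⟩ := (Real.contDiff_exp (n := 1)).contDiffOn.exists_lipschitzOnWith one_ne_zero
    (convex_Icc (0 : ℝ) (2 * ∫ s, f s)) isCompact_Icc
  have hmem : ∀ t, 2 * F t ∈ Icc (0 : ℝ) (2 * ∫ s, f s) := fun t =>
    ⟨by have := integral_Ioi_nonneg hf0 t; positivity,
      by have := integral_Ioi_le_integral hf hf0 t; simp only [hF]; linarith⟩
  have hac : ∀ b, AbsolutelyContinuousOnInterval (fun t => Real.exp (2 * F t)) x b := fun b =>
    absolutelyContinuousOnInterval_of_dist_le (K := K)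
      ((absolutelyContinuousOnInterval_integral_Ioi hf x b).const_mul 2)
      fun s _ t _ => hK.dist_le_mul _ (hmem s) _ (hmem t)
  have hd : ∀ᵐ t, HasDerivAt (fun t => Real.exp (2 * F t))
      ((-2) * (f t * Real.exp (2 * F t))) t := by
    filter_upwards [ae_hasDerivAt_integral_Ioi hf] with t ht
    convert (ht.const_mul 2).exp using 1
    ring
  refine le_of_tendsto (intervalIntegral_tendsto_integral_Ioi x hint.integrableOn tendsto_id)
    (Eventually.of_forall fun b => ?_)
  have h := integral_eq_sub_of_absolutelyContinuousOnInterval (hac b)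
    (hd.mono fun t ht _ => ht) ((hint.const_mul (-2)).intervalIntegrable)
  rw [intervalIntegral.integral_const_mul] at h
  have := Real.exp_pos (2 * F b)
  simp only [id]
  linarith

/-- Grönwall's inequality for a Volterra inequality that runs backwards from infinity. The bounded
function `v` need not be measurable. -/
theorem le_of_le_add_integral_Ioi (hf : Integrable f) (hf0 : ∀ t, 0 ≤ f t) {v : ℝ → ℝ} {a M : ℝ}
    (ha : 0 ≤ a) (hv0 : ∀ t, 0 ≤ v t) (hvM : ∀ t, v t ≤ M)
    (hv : ∀ x, v x ≤ a + ∫ t in Ioi x, f t * v t) (x : ℝ) :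
    v x ≤ 2 * a * Real.exp (2 * ∫ t in Ioi x, f t) := by
  set F : ℝ → ℝ := fun t => ∫ s in Ioi t, f s with hF
  have hF0 : ∀ t, 0 ≤ F t := integral_Ioi_nonneg hf0
  have hE : ∀ t, 1 ≤ Real.exp (2 * F t) := fun t =>
    Real.one_le_exp (by have := hF0 t; positivity)
  have hbdd : BddAbove (range fun t => v t / Real.exp (2 * F t)) := by
    refine ⟨M, ?_⟩
    rintro _ ⟨t, rfl⟩
    exact (div_le_self (hv0 t) (hE t)).trans (hvM t)
  -- the best constant in `v ≤ m exp (2 F)`; inserting this bound into `hv` gives `m ≤ a + m / 2`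
  set m : ℝ := ⨆ t, v t / Real.exp (2 * F t)
  have hm : ∀ t, v t ≤ m * Real.exp (2 * F t) := fun t =>
    (div_le_iff₀ (Real.exp_pos _)).1 (le_ciSup hbdd t)
  have hm0 : 0 ≤ m := (div_nonneg (hv0 0) (Real.exp_pos _).le).trans (le_ciSup hbdd 0)
  have key : ∀ y, v y ≤ a + m * (Real.exp (2 * F y) / 2) := fun y => by
    refine (hv y).trans (add_le_add le_rfl ?_)
    calc ∫ t in Ioi y, f t * v t
        ≤ ∫ t in Ioi y, m * (f t * Real.exp (2 * F t)) := by
          refine integral_mono_of_nonneg (Eventually.of_forall fun t => mul_nonneg (hf0 t) (hv0 t))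
            ((integrable_mul_exp_tail hf hf0).const_mul m).integrableOn
            (Eventually.of_forall fun t => ?_)
          calc f t * v t ≤ f t * (m * Real.exp (2 * F t)) :=
                mul_le_mul_of_nonneg_left (hm t) (hf0 t)
            _ = m * (f t * Real.exp (2 * F t)) := by ring
      _ = m * ∫ t in Ioi y, f t * Real.exp (2 * F t) := integral_const_mul _ _
      _ ≤ m * (Real.exp (2 * F y) / 2) :=
          mul_le_mul_of_nonneg_left (integral_mul_exp_tail_le hf hf0 y) hm0
  have hma : m ≤ a + m / 2 := ciSup_le fun y => by
    rw [div_le_iff₀ (Real.exp_pos _)]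
    have h1 := key y
    have h2 := le_mul_of_one_le_right ha (hE y)
    linarith
  exact (hm x).trans (mul_le_mul_of_nonneg_right (by linarith) (Real.exp_pos _).le)

end Volterra

section FixedPoint

variable {E : Type*} [NormedRing E] {P Pinv R : ℝ → E} {C : ℝ}

theorem integrable_mul_mul_of_bounded (hPi : Continuous Pinv) (hPiC : ∀ t, ‖Pinv t‖ ≤ C)
    (hR : Integrable R) {V : ℝ → E} (hV : Continuous V) {M : ℝ} (hVM : ∀ t, ‖V t‖ ≤ M) :
    Integrable fun t => Pinv t * (R t * V t) :=
  (hR.mul_bdd hV.aestronglyMeasurable (Eventually.of_forall hVM)).bdd_mul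
    hPi.aestronglyMeasurable (Eventually.of_forall hPiC)

/-- Only the product `P(x) Pinv(t)` with `x ≤ t` is controlled, so `P(x)` has to be taken under the
integral before estimating. -/
theorem norm_mul_integral_Ioi_le [NormedAlgebra ℝ E] (hC : ∀ x t, x ≤ t → ‖P x * Pinv t‖ ≤ C)
    {S : ℝ → E} (hS : Integrable fun t => Pinv t * S t) {g : ℝ → ℝ} (hg : Integrable g)
    (hSg : ∀ t, C * ‖S t‖ ≤ g t) (x : ℝ) :
    ‖P x * ∫ t in Ioi x, Pinv t * S t‖ ≤ ∫ t in Ioi x, g t := by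
  rw [← integral_const_mul_of_integrable hS.integrableOn]
  refine norm_integral_le_of_norm_le hg.integrableOn ?_
  refine (ae_restrict_iff' measurableSet_Ioi).2 (Eventually.of_forall fun t ht => ?_)
  rw [← mul_assoc]
  exact (norm_mul_le _ _).trans ((mul_le_mul_of_nonneg_right (hC x t (le_of_lt ht))
    (norm_nonneg _)).trans (hSg t))

/-- The Volterra equation `V(x) = h(x) - P(x) ∫_x^∞ Pinv(t) R(t) V(t) dt` has a bounded continuous
solution. -/
theorem exists_volterra_solution [NormedAlgebra ℝ E] [CompleteSpace E] (hP : Continuous P)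
    (hPi : Continuous Pinv)
    (hPiC : ∀ t, ‖Pinv t‖ ≤ C) (hC : ∀ x t, x ≤ t → ‖P x * Pinv t‖ ≤ C) (hR : Integrable R)
    {h : ℝ → E} (hh : Continuous h) {H : ℝ} (hH : ∀ x, ‖h x‖ ≤ H) :
    ∃ V : ℝ → E, Continuous V ∧ (∃ M, ∀ x, ‖V x‖ ≤ M) ∧
      ∀ x, V x = h x - P x * ∫ t in Ioi x, Pinv t * (R t * V t) := by
  have hC0 : 0 ≤ C := (norm_nonneg _).trans (hPiC 0)
  set f : ℝ → ℝ := fun t => C * ‖R t‖ with hf_def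
  have hf : Integrable f := hR.norm.const_mul C
  have hf0 : ∀ t, 0 ≤ f t := fun t => mul_nonneg hC0 (norm_nonneg _)
  set w : ℝ → ℝ := fun t => Real.exp (2 * ∫ s in Ioi t, f s) with hw_def
  have hw : Continuous w :=
    Real.continuous_exp.comp (continuous_const.mul (continuous_integral_Ioi hf))
  have hw0 : ∀ t, 0 < w t := fun t => Real.exp_pos _
  have hw1 : ∀ t, 1 ≤ w t := fun t =>
    Real.one_le_exp (mul_nonneg zero_le_two (integral_Ioi_nonneg hf0 t))
  have hwB : ∀ t, w t ≤ Real.exp (2 * ∫ s, f s) := fun t =>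
    Real.exp_le_exp.2 (mul_le_mul_of_nonneg_left (integral_Ioi_le_integral hf hf0 t) zero_le_two)
  have hwV : ∀ U : BoundedContinuousFunction ℝ E, ∀ t,
      ‖w t • U t‖ ≤ Real.exp (2 * ∫ s, f s) * ‖U‖ := fun U t => by
    rw [norm_smul, Real.norm_of_nonneg (hw0 t).le]
    exact mul_le_mul (hwB t) (U.norm_coe_le_norm t) (norm_nonneg _) (Real.exp_pos _).le
  have hint : ∀ U : BoundedContinuousFunction ℝ E,
      Integrable fun t => Pinv t * (R t * (w t • U t)) := fun U =>
    integrable_mul_mul_of_bounded hPi hPiC hR (hw.smul U.continuous) (hwV U)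
  -- the integral term of the equation for `U = V / w`, and its contraction estimate
  set J : BoundedContinuousFunction ℝ E → ℝ → E := fun U x =>
    P x * ∫ t in Ioi x, Pinv t * (R t * (w t • U t)) with hJ
  have hJbound : ∀ U x, ‖J U x‖ ≤ w x * (‖U‖ / 2) := fun U x => by
    refine (norm_mul_integral_Ioi_le hC (hint U)
      (((integrable_mul_exp_tail hf hf0)).const_mul ‖U‖) (fun t => ?_) x).trans ?_
    · calc C * ‖R t * (w t • U t)‖ ≤ C * (‖R t‖ * (w t * ‖U‖)) := by
            refine mul_le_mul_of_nonneg_left ((norm_mul_le _ _).trans ?_) hC0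
            rw [norm_smul, Real.norm_of_nonneg (hw0 t).le]
            exact mul_le_mul_of_nonneg_left (mul_le_mul_of_nonneg_left (U.norm_coe_le_norm t)
              (hw0 t).le) (norm_nonneg _)
        _ = ‖U‖ * (f t * w t) := by simp only [hf_def]; ring
    · rw [integral_const_mul]
      calc _ ≤ ‖U‖ * (w x / 2) :=
            mul_le_mul_of_nonneg_left (integral_mul_exp_tail_le hf hf0 x) (norm_nonneg _)
        _ = w x * (‖U‖ / 2) := by ring
  have hJcont : ∀ U, Continuous (J U) := fun U => hP.mul (continuous_integral_Ioi (hint U))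
  have hJsub : ∀ U U' x, J U x - J U' x = J (U - U') x := fun U U' x => by
    simp only [hJ]
    rw [← mul_sub, ← integral_sub (hint U).integrableOn (hint U').integrableOn]
    congr 2
    ext t
    rw [BoundedContinuousFunction.sub_apply, smul_sub, mul_sub, mul_sub]
  -- dividing the equation by `w` makes its right-hand side a self-map of the space of `U`
  set T : BoundedContinuousFunction ℝ E → BoundedContinuousFunction ℝ E := fun U =>
    BoundedContinuousFunction.ofNormedAddCommGroup (fun x => (w x)⁻¹ • (h x - J U x))
      ((hw.inv₀ fun x => (hw0 x).ne').smul (hh.sub (hJcont U))) (H + ‖U‖ / 2) (fun x => by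
        have hwi : (w x)⁻¹ ≤ 1 := inv_le_one_of_one_le₀ (hw1 x)
        have hwi0 : 0 ≤ (w x)⁻¹ := (inv_pos.2 (hw0 x)).le
        rw [norm_smul, Real.norm_of_nonneg hwi0]
        calc (w x)⁻¹ * ‖h x - J U x‖ ≤ (w x)⁻¹ * (H + w x * (‖U‖ / 2)) := by
              gcongr
              exact (norm_sub_le _ _).trans (add_le_add (hH x) (hJbound U x))
          _ = (w x)⁻¹ * H + ‖U‖ / 2 := by have := (hw0 x).ne'; field_simp
          _ ≤ H + ‖U‖ / 2 := by
              have := mul_le_of_le_one_left ((norm_nonneg _).trans (hH x)) hwi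
              linarith) with hT
  have hTapp : ∀ U x, T U x = (w x)⁻¹ • (h x - J U x) := fun U x => rfl
  have hcontr : ContractingWith (1 / 2 : NNReal) T := by
    refine ⟨by norm_num, LipschitzWith.of_dist_le_mul fun U U' => ?_⟩
    refine (BoundedContinuousFunction.dist_le (by positivity)).2 fun x => ?_
    rw [dist_eq_norm, hTapp, hTapp, ← smul_sub, sub_sub_sub_cancel_left, hJsub, norm_smul,
      Real.norm_of_nonneg (inv_pos.2 (hw0 x)).le, inv_mul_le_iff₀ (hw0 x)]
    refine (hJbound _ x).trans (le_of_eq ?_)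
    rw [dist_comm, dist_eq_norm]
    simp only [NNReal.coe_div, NNReal.coe_one, NNReal.coe_ofNat]
    ring
  set U := ContractingWith.fixedPoint T hcontr
  have hU : T U = U := ContractingWith.fixedPoint_isFixedPt hcontr
  refine ⟨fun x => w x • U x, hw.smul U.continuous, ⟨_, hwV U⟩, fun x => ?_⟩
  have := hTapp U x
  rw [hU] at this
  simp only
  rw [this, smul_inv_smul₀ (hw0 x).ne']

end FixedPoint

/-! ### Carathéodory solutions and variation of constants -/

section Solutions

variable {d : ℕ} {A Φ B Y Z : ℝ → Mat d}

theorem IsSolutionOn.ae_hasDerivAt (hY : IsSolutionOn (Ici 0) B Y) :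
    ∀ᵐ x, 0 ≤ x → HasDerivAt Y (B x * Y x) x := by
  have h0 : ∀ᵐ x : ℝ, x ≠ 0 := by simp [ae_iff]
  filter_upwards [(ae_restrict_iff' measurableSet_Ici).1 hY.2, h0] with x hx hx0 hx1
  exact (hx hx1).hasDerivAt (Ici_mem_nhds (lt_of_le_of_ne hx1 hx0.symm))

theorem isSolutionOn_Ici_of_ae
    (hY : ∀ a, 0 ≤ a → ∀ b, 0 ≤ b → AbsolutelyContinuousOnInterval Y a b)
    (h : ∀ᵐ x, 0 < x → HasDerivAt Y (B x * Y x) x) : IsSolutionOn (Ici 0) B Y := by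
  refine ⟨hY, (ae_restrict_iff' measurableSet_Ici).2 ?_⟩
  have h0 : ∀ᵐ x : ℝ, x ≠ 0 := by simp [ae_iff]
  filter_upwards [h, h0] with x hx hx0 hx1
  exact (hx (lt_of_le_of_ne hx1 hx0.symm)).hasDerivWithinAt

theorem IsFundamentalSolution.isSolutionOn_Ici (hΦ : IsFundamentalSolution A Φ) :
    IsSolutionOn (Ici 0) A Φ := by
  refine isSolutionOn_Ici_of_ae (fun a _ b _ => hΦ.1.1 a (mem_univ a) b (mem_univ b)) ?_
  have h := hΦ.1.2
  rw [Measure.restrict_univ] at h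
  filter_upwards [h] with x hx _
  exact hasDerivWithinAt_univ.1 hx

theorem IsSolutionOn.continuousOn (hY : IsSolutionOn (Ici 0) B Y) : ContinuousOn Y (Ici 0) := by
  intro x hx
  have hx1 : (0 : ℝ) ≤ x + 1 := by have := mem_Ici.1 hx; linarith
  have h := (hY.1 0 self_mem_Ici (x + 1) hx1).continuousOn
  rw [uIcc_of_le hx1] at h
  refine (h x ⟨hx, by linarith⟩).mono_of_mem_nhdsWithin ?_
  exact mem_nhdsWithin.2 ⟨Iio (x + 1), isOpen_Iio, by simp, fun y hy => ⟨hy.2, hy.1.le⟩⟩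

theorem IsSolutionOn.sub (hY : IsSolutionOn (Ici 0) B Y) (hZ : IsSolutionOn (Ici 0) B Z) :
    IsSolutionOn (Ici 0) B fun x => Y x - Z x := by
  refine isSolutionOn_Ici_of_ae
    (fun a ha b hb => (hY.1 a ha b hb).fun_sub (hZ.1 a ha b hb)) ?_
  filter_upwards [hY.ae_hasDerivAt, hZ.ae_hasDerivAt] with x h1 h2 hx
  rw [mul_sub]
  exact (h1 hx.le).sub (h2 hx.le)

theorem IsSolutionOn.mul_const (hY : IsSolutionOn (Ici 0) B Y) (N : Mat d) :
    IsSolutionOn (Ici 0) B fun x => Y x * N := by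
  refine isSolutionOn_Ici_of_ae (fun a ha b hb =>
    absolutelyContinuousOnInterval_of_dist_le (K := ‖N‖) (hY.1 a ha b hb) fun x _ y _ => ?_) ?_
  · rw [dist_eq_norm, dist_eq_norm, ← sub_mul, mul_comm ‖N‖]
    exact norm_mul_le _ _
  · filter_upwards [hY.ae_hasDerivAt] with x h1 hx
    rw [← mul_assoc]
    exact (h1 hx.le).mul_const N

/-- Backward uniqueness: a solution on `[0, ∞)` that vanishes somewhere vanishes at `0`. -/
theorem IsSolutionOn.eq_zero_of_eq_zero (hA : LocallyIntegrable A volume)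
    (hY : IsSolutionOn (Ici 0) A Y) {b : ℝ} (hb : 0 ≤ b) (hYb : Y b = 0) : Y 0 = 0 := by
  have hAb : IntegrableOn A (Icc 0 b) := hA.integrableOn_isCompact isCompact_Icc
  obtain ⟨M, hM⟩ := isCompact_Icc.exists_bound_of_continuousOn
    (hY.continuousOn.mono (Icc_subset_Ici_self : Icc 0 b ⊆ Ici 0))
  have hYm : AEStronglyMeasurable Y (volume.restrict (Icc 0 b)) :=
    (hY.continuousOn.mono Icc_subset_Ici_self).aestronglyMeasurable measurableSet_Icc
  have hYM : ∀ᵐ t ∂volume.restrict (Icc 0 b), ‖Y t‖ ≤ M :=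
    (ae_restrict_iff' measurableSet_Icc).2 (Eventually.of_forall hM)
  have hAYn : IntegrableOn (fun t => ‖A t‖ * ‖Y t‖) (Icc 0 b) :=
    Integrable.mul_bdd (Integrable.norm hAb) hYm.norm (by simpa using hYM)
  have hAY : IntegrableOn (fun t => A t * Y t) (Icc 0 b) :=
    Integrable.mul_bdd hAb hYm hYM
  -- cutting off to `[0, b]` makes `Y(x) = -∫_x^b A Y` an inequality on `ℝ` with integrable density
  set f : ℝ → ℝ := (Icc 0 b).indicator fun t => ‖A t‖
  set v : ℝ → ℝ := (Icc 0 b).indicator fun t => ‖Y t‖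
  have hf : Integrable f := (integrable_indicator_iff measurableSet_Icc).2 (Integrable.norm hAb)
  have hf0 : ∀ t, 0 ≤ f t := fun t => indicator_nonneg (fun _ _ => norm_nonneg _) t
  have hv0 : ∀ t, 0 ≤ v t := fun t => indicator_nonneg (fun _ _ => norm_nonneg _) t
  have h0 : (0 : ℝ) ∈ Icc 0 b := ⟨le_rfl, hb⟩
  have hvM : ∀ t, v t ≤ M := fun t =>
    indicator_le' (fun s hs => hM s hs) (fun _ _ => (norm_nonneg _).trans (hM 0 h0)) t
  have hfv : ∀ t, f t * v t = (Icc 0 b).indicator (fun t => ‖A t‖ * ‖Y t‖) t := fun t => by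
    by_cases ht : t ∈ Icc 0 b <;> simp [f, v, ht]
  have hv : ∀ x, v x ≤ 0 + ∫ t in Ioi x, f t * v t := fun x => by
    rw [zero_add]
    have hpos : 0 ≤ ∫ t in Ioi x, f t * v t :=
      integral_nonneg fun t => mul_nonneg (hf0 t) (hv0 t)
    by_cases hx : x ∈ Icc 0 b
    swap
    · simpa [v, hx] using hpos
    have hsub : uIcc x b ⊆ Icc 0 b := by
      rw [uIcc_of_le hx.2]
      exact Icc_subset_Icc_left hx.1
    have hftc := integral_eq_sub_of_absolutelyContinuousOnInterval (hY.1 x hx.1 b hb)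
      (hY.ae_hasDerivAt.mono fun t ht ht' => ht (hsub ht').1)
      ((hAY.mono_set hsub).intervalIntegrable)
    rw [hYb, zero_sub] at hftc
    have hset : Ioi x ∩ Icc 0 b = Ioc x b := by
      ext t
      simp only [mem_inter_iff, mem_Ioi, mem_Icc, mem_Ioc]
      exact ⟨fun h => ⟨h.1, h.2.2⟩, fun h => ⟨h.1, hx.1.trans h.1.le, h.2⟩⟩
    simp_rw [hfv]
    rw [setIntegral_indicator measurableSet_Icc, hset]
    simp only [v, indicator_of_mem hx]
    rw [← norm_neg, ← hftc, intervalIntegral.integral_of_le hx.2]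
    rw [uIcc_of_le hx.2] at hsub
    exact norm_integral_le_of_norm_le (hAYn.mono_set (Ioc_subset_Icc_self.trans hsub))
      (Eventually.of_forall fun t => norm_mul_le _ _)
  have h := le_of_le_add_integral_Ioi hf hf0 le_rfl hv0 hvM hv 0
  rw [mul_zero, zero_mul] at h
  simpa [v, h0] using h

/-- A vector `v` in the kernel of `Φ(x)` would give a solution that vanishes at `x` and equals `v`
at `0`. -/
theorem IsFundamentalSolution.isUnit_det (hA : LocallyIntegrable A volume)
    (hΦ : IsFundamentalSolution A Φ) {x : ℝ} (hx : 0 ≤ x) : IsUnit (Φ x).det := by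
  rw [isUnit_iff_ne_zero]
  intro hdet
  obtain ⟨v, hv0, hv⟩ := Matrix.exists_mulVec_eq_zero_iff.2 hdet
  obtain ⟨i, hi⟩ := Function.ne_iff.1 hv0
  set N : Mat d := Matrix.of fun i _ => v i
  have hN : Φ x * N = 0 := by
    ext j l
    exact congrFun hv j
  have h := (hΦ.isSolutionOn_Ici.mul_const N).eq_zero_of_eq_zero hA hx hN
  rw [hΦ.2, one_mul] at h
  exact hi (congrFun (congrFun h i) i)

theorem IsFundamentalSolution.mul_inv (hA : LocallyIntegrable A volume)
    (hΦ : IsFundamentalSolution A Φ) {x : ℝ} (hx : 0 ≤ x) : Φ x * (Φ x)⁻¹ = 1 :=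
  Matrix.mul_nonsing_inv _ (hΦ.isUnit_det hA hx)

theorem IsFundamentalSolution.inv_mul (hA : LocallyIntegrable A volume)
    (hΦ : IsFundamentalSolution A Φ) {x : ℝ} (hx : 0 ≤ x) : (Φ x)⁻¹ * Φ x = 1 :=
  Matrix.nonsing_inv_mul _ (hΦ.isUnit_det hA hx)

theorem hasFDerivAt_matrix_inv {M : Mat d} (hM : IsUnit M.det) :
    HasFDerivAt (fun N : Mat d => N⁻¹)
      (-ContinuousLinearMap.mulLeftRight ℝ (Mat d) M⁻¹ M⁻¹) M := by
  obtain ⟨u, rfl⟩ := (Matrix.isUnit_iff_isUnit_det M).2 hM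
  have h := hasFDerivAt_ringInverse (𝕜 := ℝ) u
  have hinv : (fun N : Mat d => N⁻¹) = Ring.inverse := funext Matrix.nonsing_inv_eq_ringInverse
  rw [hinv, Matrix.nonsing_inv_eq_ringInverse, Ring.inverse_unit]
  exact h

theorem IsFundamentalSolution.continuousOn_inv (hA : LocallyIntegrable A volume)
    (hΦ : IsFundamentalSolution A Φ) : ContinuousOn (fun x => (Φ x)⁻¹) (Ici 0) := fun x hx =>
  (hasFDerivAt_matrix_inv (hΦ.isUnit_det hA hx)).continuousAt.comp_continuousWithinAt
    (hΦ.isSolutionOn_Ici.continuousOn x hx)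

theorem IsFundamentalSolution.absolutelyContinuousOnInterval_inv (hA : LocallyIntegrable A volume)
    (hΦ : IsFundamentalSolution A Φ) {a b : ℝ} (ha : 0 ≤ a) (hb : 0 ≤ b) :
    AbsolutelyContinuousOnInterval (fun x => (Φ x)⁻¹) a b := by
  have hsub : uIcc a b ⊆ Ici 0 := fun x hx => (le_inf ha hb).trans hx.1
  obtain ⟨M, hM⟩ := isCompact_uIcc.exists_bound_of_continuousOn
    ((hΦ.continuousOn_inv hA).mono hsub)
  have hM0 : 0 ≤ M := (norm_nonneg _).trans (hM a left_mem_uIcc)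
  refine absolutelyContinuousOnInterval_of_dist_le (K := M * M)
    (hΦ.isSolutionOn_Ici.1 a ha b hb) fun x hx y hy => ?_
  have h : (Φ x)⁻¹ - (Φ y)⁻¹ = (Φ x)⁻¹ * (Φ y - Φ x) * (Φ y)⁻¹ := by
    rw [mul_sub, sub_mul, mul_assoc, hΦ.mul_inv hA (hsub hy), hΦ.inv_mul hA (hsub hx), mul_one,
      one_mul]
  rw [dist_eq_norm, h, dist_comm, dist_eq_norm]
  calc ‖(Φ x)⁻¹ * (Φ y - Φ x) * (Φ y)⁻¹‖ ≤ M * ‖Φ y - Φ x‖ * M :=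
        (norm_mul_le _ _).trans (mul_le_mul ((norm_mul_le _ _).trans
          (mul_le_mul_of_nonneg_right (hM x hx) (norm_nonneg _))) (hM y hy) (norm_nonneg _)
          (mul_nonneg hM0 (norm_nonneg _)))
    _ = M * M * ‖Φ y - Φ x‖ := by ring

theorem IsFundamentalSolution.ae_hasDerivAt_inv (hA : LocallyIntegrable A volume)
    (hΦ : IsFundamentalSolution A Φ) :
    ∀ᵐ x, 0 ≤ x → HasDerivAt (fun x => (Φ x)⁻¹) (-((Φ x)⁻¹ * A x)) x := by
  filter_upwards [hΦ.isSolutionOn_Ici.ae_hasDerivAt] with x h hx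
  have := (hasFDerivAt_matrix_inv (hΦ.isUnit_det hA hx)).comp_hasDerivAt x (h hx)
  convert! this using 1
  simp only [neg_apply, ContinuousLinearMap.mulLeftRight_apply]
  rw [mul_assoc, mul_assoc, hΦ.mul_inv hA hx, mul_one]

/-- Variation of constants: in the moving frame `Φ`, a solution of the perturbed equation has
derivative `Φ⁻¹ R Y`. -/
theorem IsFundamentalSolution.inv_mul_sub_inv_mul_eq_integral (hA : LocallyIntegrable A volume)
    (hΦ : IsFundamentalSolution A Φ) {R : ℝ → Mat d}
    (hY : IsSolutionOn (Ici 0) (fun x => A x + R x) Y) {a b : ℝ} (ha : 0 ≤ a) (hab : a ≤ b)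
    (hint : IntervalIntegrable (fun t => (Φ t)⁻¹ * (R t * Y t)) volume a b) :
    (Φ b)⁻¹ * Y b - (Φ a)⁻¹ * Y a = ∫ t in a..b, (Φ t)⁻¹ * (R t * Y t) := by
  refine (integral_eq_sub_of_absolutelyContinuousOnInterval
    (f := fun t => (Φ t)⁻¹ * Y t) ?_ ?_ hint).symm
  · exact absolutelyContinuousOnInterval_mul
      (hΦ.absolutelyContinuousOnInterval_inv hA ha (ha.trans hab)) (hY.1 a ha b (ha.trans hab))
  · filter_upwards [hΦ.ae_hasDerivAt_inv hA, hY.ae_hasDerivAt] with t h1 h2 ht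
    rw [uIcc_of_le hab] at ht
    convert! (h1 (ha.trans ht.1)).mul (h2 (ha.trans ht.1)) using 1
    noncomm_ring

/-- Converse of variation of constants, with the data prescribed at infinity: the integral equation
implies the differential equation. -/
theorem IsFundamentalSolution.isSolutionOn_mul_integral_Ioi (hA : LocallyIntegrable A volume)
    (hΦ : IsFundamentalSolution A Φ) {R g : ℝ → Mat d} (hg : Integrable g) (N : Mat d)
    (hY : ∀ x, 0 ≤ x → Y x = Φ x * (N - ∫ t in Ioi x, g t))
    (hgY : ∀ x, 0 < x → g x = (Φ x)⁻¹ * (R x * Y x)) :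
    IsSolutionOn (Ici 0) (fun x => A x + R x) Y := by
  refine isSolutionOn_Ici_of_ae (fun a ha b hb => ?_) ?_
  · have hU : AbsolutelyContinuousOnInterval (fun x => N - ∫ t in Ioi x, g t) a b :=
      absolutelyContinuousOnInterval_of_dist_le (K := 1)
        (absolutelyContinuousOnInterval_integral_Ioi hg a b) fun x _ y _ => by
          rw [dist_sub_left, one_mul]
    exact absolutelyContinuousOnInterval_congr
      (absolutelyContinuousOnInterval_mul (hΦ.isSolutionOn_Ici.1 a ha b hb) hU)
      fun x hx => hY x ((le_inf ha hb).trans hx.1)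
  · filter_upwards [hΦ.isSolutionOn_Ici.ae_hasDerivAt, ae_hasDerivAt_integral_Ioi hg]
      with x h1 h2 hx
    have h3 := (h1 hx.le).mul (h2.const_sub N)
    have h4 : Y =ᶠ[𝓝 x] fun x => Φ x * (N - ∫ t in Ioi x, g t) := by
      filter_upwards [Ioi_mem_nhds hx] with y hy using hY y (le_of_lt hy)
    refine HasDerivAt.congr_of_eventuallyEq ?_ h4
    convert! h3 using 1
    rw [neg_neg, hgY x hx, ← mul_assoc, hΦ.mul_inv hA hx.le, one_mul, mul_assoc, ← hY x hx.le,
      add_mul]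

end Solutions

/-! ### Lyapunov and Bohl exponents -/

section Exponents

variable {d : ℕ} {A Φ F : ℝ → Mat d} {Q : Mat d}

/-- Includes `N = 0`, where the quotient is `⊥ / x = ⊥`. -/
theorem log_enorm_div_le_iff {N : Mat d} {l x : ℝ} (hx : 0 < x) :
    ENNReal.log ‖N‖ₑ / (x : EReal) ≤ (l : EReal) ↔ ‖N‖ ≤ Real.exp (l * x) := by
  rw [EReal.div_le_iff_le_mul (by exact_mod_cast hx) (EReal.coe_ne_top x), ← EReal.coe_mul,
    ← EReal.log_exp ((x * l : ℝ) : EReal), ENNReal.log_le_log_iff, EReal.exp_coe,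
    ← ofReal_norm, ENNReal.ofReal_le_ofReal_iff (Real.exp_pos _).le, mul_comm x l]

theorem exists_norm_le_of_expRate_lt (hF : ContinuousOn F (Ici 0)) {l : ℝ}
    (h : expRate F < (l : EReal)) :
    ∃ C, ∀ x, 0 ≤ x → ‖F x‖ ≤ C * Real.exp (l * x) := by
  obtain ⟨a, ha⟩ := eventually_atTop.1
    ((eventually_lt_of_limsup_lt h).and (eventually_gt_atTop (0 : ℝ)))
  obtain ⟨M, hM⟩ := (isCompact_Icc (a := (0 : ℝ)) (b := a)).exists_bound_of_continuousOn
    (f := fun x => Real.exp (-(l * x)) • F x)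
    (ContinuousOn.smul (Continuous.continuousOn
      (Real.continuous_exp.comp (continuous_const.mul continuous_id).neg))
      (hF.mono Icc_subset_Ici_self))
  refine ⟨max M 1, fun x hx => ?_⟩
  rcases le_total a x with hax | hax
  · obtain ⟨h1, h2⟩ := ha x hax
    exact ((log_enorm_div_le_iff h2).1 h1.le).trans
      (le_mul_of_one_le_left (Real.exp_pos _).le (le_max_right _ _))
  · have := hM x ⟨hx, hax⟩
    rw [norm_smul, Real.norm_of_nonneg (Real.exp_pos _).le, Real.exp_neg,
      inv_mul_le_iff₀ (Real.exp_pos _), mul_comm] at this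
    exact this.trans (mul_le_mul_of_nonneg_right (le_max_left _ _) (Real.exp_pos _).le)

theorem expRate_le_of_norm_le {C k l : ℝ} (hkl : k < l)
    (h : ∀ x, 0 ≤ x → ‖F x‖ ≤ C * Real.exp (k * x)) : expRate F ≤ (l : EReal) := by
  have ht : Tendsto (fun x : ℝ => C * Real.exp (-((l - k) * x))) atTop (𝓝 (C * 0)) :=
    (Real.tendsto_exp_neg_atTop_nhds_zero.comp
      (tendsto_id.const_mul_atTop (sub_pos.2 hkl))).const_mul C
  rw [mul_zero] at ht
  refine limsup_le_of_le (by isBoundedDefault) ?_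
  filter_upwards [ht.eventually_le_const one_pos, eventually_gt_atTop (0 : ℝ)] with x h1 hx
  refine (log_enorm_div_le_iff hx).2 ((h x hx.le).trans ?_)
  calc C * Real.exp (k * x) = C * Real.exp (-((l - k) * x)) * Real.exp (l * x) := by
        rw [mul_assoc, ← Real.exp_add]; ring_nf
    _ ≤ Real.exp (l * x) := mul_le_of_le_one_left (Real.exp_pos _).le h1

theorem exists_norm_le_of_lt_lowerBohl {k : ℝ} (hk : (k : EReal) < lowerBohl Φ Q) :
    ∃ C : ℝ, 1 ≤ C ∧ ∀ x x' : ℝ, 0 ≤ x → x ≤ x' →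
      ‖Φ x * Q * (Φ x')⁻¹‖ ≤ C * Real.exp (k * (x - x')) := by
  obtain ⟨_, ⟨k', rfl, C, hC, h⟩, hkk'⟩ := lt_sSup_iff.1 hk
  refine ⟨C, hC, fun x x' hx hxx' => (h x x' hx hxx').trans ?_⟩
  have hkk := EReal.coe_lt_coe_iff.1 hkk'
  refine mul_le_mul_of_nonneg_left (Real.exp_le_exp.2 ?_) (zero_le_one.trans hC)
  exact mul_le_mul_of_nonpos_right hkk.le (sub_nonpos.2 hxx')

/-- The lower Bohl exponent of a nontrivial dichotomy is not positive: for `k > 0` the bounds on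
`Q Φ(x)⁻¹` and on `Φ(x) Q` would make their product `Q` tend to `0`. -/
theorem lowerBohl_le_zero (hA : LocallyIntegrable A volume) (hΦ : IsFundamentalSolution A Φ)
    (hQ : IsExponentialDichotomy Φ Q) (hQ0 : Q ≠ 0) : lowerBohl Φ Q ≤ 0 := by
  refine sSup_le ?_
  rintro _ ⟨k, rfl, C, hC, h⟩
  by_contra! hk
  have hk0 : 0 < k := by exact_mod_cast hk
  obtain ⟨hidem, k₀, -, C₀, -, hk₀, -, hC₀, -, h₀, -⟩ := hQ
  have hb : ∀ x, 0 ≤ x → ‖Q‖ ≤ C * C₀ * Real.exp (-(k₀ * x)) := fun x hx => by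
    have h1 := h 0 x le_rfl hx
    have h2 := h₀ x 0 hx
    rw [hΦ.2, one_mul, zero_sub] at h1
    rw [hΦ.2, inv_one, mul_one, sub_zero] at h2
    have h3 : Q = Q * (Φ x)⁻¹ * (Φ x * Q) := by
      rw [mul_assoc, ← mul_assoc (Φ x)⁻¹, hΦ.inv_mul hA hx, one_mul, hidem.eq]
    calc ‖Q‖ ≤ ‖Q * (Φ x)⁻¹‖ * ‖Φ x * Q‖ := by
          conv_lhs => rw [h3]
          exact norm_mul_le _ _
      _ ≤ (C * 1) * (C₀ * Real.exp (-k₀ * x)) := by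
          refine mul_le_mul (h1.trans (mul_le_mul_of_nonneg_left ?_ (by linarith))) h2
            (norm_nonneg _) (by linarith)
          refine Real.exp_le_one_iff.2 ?_
          have := mul_nonneg hk0.le hx
          linarith
      _ = C * C₀ * Real.exp (-(k₀ * x)) := by ring_nf
  have ht : Tendsto (fun x : ℝ => C * C₀ * Real.exp (-(k₀ * x))) atTop (𝓝 (C * C₀ * 0)) :=
    (Real.tendsto_exp_neg_atTop_nhds_zero.comp (tendsto_id.const_mul_atTop hk₀)).const_mul _
  rw [mul_zero] at ht
  have := ge_of_tendsto ht ((eventually_ge_atTop (0 : ℝ)).mono hb)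
  exact hQ0 (norm_le_zero_iff.1 this)

/-- The bound over unit steps is chained over `⌊x' - x⌋ + 1` steps. -/
theorem ExponentiallyBounded.exists_norm_le (hA : LocallyIntegrable A volume)
    (hΦ : IsFundamentalSolution A Φ) (hbdd : ExponentiallyBounded Φ) :
    ∃ M : ℝ, 1 ≤ M ∧ ∀ x x' : ℝ, 0 ≤ x → x ≤ x' →
      ‖Φ x * (Φ x')⁻¹‖ ≤ M * Real.exp (Real.log M * (x' - x)) := by
  obtain ⟨C, hC⟩ := hbdd
  set M : ℝ := max C 1
  have hM1 : 1 ≤ M := le_max_right _ _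
  have hM0 : 0 < M := zero_lt_one.trans_le hM1
  have key : ∀ n : ℕ, ∀ x x' : ℝ, 0 ≤ x → x ≤ x' → x' ≤ x + (n + 1) →
      ‖Φ x * (Φ x')⁻¹‖ ≤ M ^ (n + 1) := by
    intro n
    induction n with
    | zero =>
      intro x x' hx hxx' hx'
      rw [zero_add, pow_one]
      refine (hC x x' ?_).trans (le_max_left _ _)
      rw [abs_sub_comm, abs_of_nonneg (sub_nonneg.2 hxx')]
      push_cast at hx'
      linarith
    | succ n ih =>
      intro x x' hx hxx' hx'
      have hM : ‖Φ x * (Φ (min x' (x + 1)))⁻¹‖ ≤ M := by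
        refine (hC _ _ ?_).trans (le_max_left _ _)
        rw [abs_sub_comm, abs_of_nonneg (sub_nonneg.2 (le_min hxx' (by linarith)))]
        linarith [min_le_right x' (x + 1)]
      have hy0 : 0 ≤ min x' (x + 1) := le_min (hx.trans hxx') (by linarith)
      have h1 := ih (min x' (x + 1)) x' hy0 (min_le_left _ _) (by
        push_cast at hx'
        rcases min_choice x' (x + 1) with h | h <;> rw [h]
        · have : (0 : ℝ) ≤ n := n.cast_nonneg
          linarith
        · linarith)
      have h2 : Φ x * (Φ x')⁻¹ =
          Φ x * (Φ (min x' (x + 1)))⁻¹ * (Φ (min x' (x + 1)) * (Φ x')⁻¹) := by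
        rw [mul_assoc, ← mul_assoc (Φ _)⁻¹, hΦ.inv_mul hA hy0, one_mul]
      rw [h2, pow_succ' M (n + 1)]
      exact (norm_mul_le _ _).trans (mul_le_mul hM h1 (norm_nonneg _) hM0.le)
  refine ⟨M, hM1, fun x x' hx hxx' => (key ⌊x' - x⌋₊ x x' hx hxx' ?_).trans ?_⟩
  · have := Nat.lt_floor_add_one (x' - x)
    linarith
  · rw [pow_succ', ← Real.exp_log hM0, Real.log_exp, ← Real.exp_nat_mul]
    refine mul_le_mul_of_nonneg_left (Real.exp_le_exp.2 ?_) (Real.exp_pos _).le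
    rw [mul_comm]
    exact mul_le_mul_of_nonneg_left (Nat.floor_le (sub_nonneg.2 hxx')) (Real.log_nonneg hM1)

/-- Moving the projected propagator from `(x, x')` to the diagonal costs at most the exponential
growth of the full propagator. -/
theorem lowerBohl_ne_bot (hA : LocallyIntegrable A volume) (hΦ : IsFundamentalSolution A Φ)
    (hbdd : ExponentiallyBounded Φ) (hQ : IsExponentialDichotomy Φ Q) : lowerBohl Φ Q ≠ ⊥ := by
  obtain ⟨M, hM, hb⟩ := hbdd.exists_norm_le hA hΦ
  obtain ⟨-, k₀, -, C₀, -, hk₀, -, hC₀, -, h₀, -⟩ := hQ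
  refine ne_bot_of_le_ne_bot (EReal.coe_ne_bot (-Real.log M)) (le_sSup ⟨_, rfl, M * C₀,
    one_le_mul_of_one_le_of_one_le hM hC₀, fun x x' hx hxx' => ?_⟩)
  have h1 : Φ x * Q * (Φ x')⁻¹ = Φ x * (Φ x')⁻¹ * (Φ x' * Q * (Φ x')⁻¹) := by
    rw [← mul_assoc, ← mul_assoc, mul_assoc (Φ x) (Φ x')⁻¹ (Φ x'),
      hΦ.inv_mul hA (hx.trans hxx'), mul_one]
  have h2 := h₀ x' x' le_rfl
  rw [sub_self, mul_zero, Real.exp_zero, mul_one] at h2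
  rw [h1]
  calc _ ≤ M * Real.exp (Real.log M * (x' - x)) * C₀ :=
        (norm_mul_le _ _).trans (mul_le_mul (hb x x' hx hxx') h2 (norm_nonneg _)
          (mul_nonneg (zero_le_one.trans hM) (Real.exp_pos _).le))
    _ = M * C₀ * Real.exp (-Real.log M * (x - x')) := by ring_nf

/-- Below the lower Bohl exponent the exponential bound holds for the full propagator, because the
complementary projection grows at a positive rate. -/
theorem exists_norm_propagator_le (hA : LocallyIntegrable A volume)
    (hΦ : IsFundamentalSolution A Φ) (hQ : IsExponentialDichotomy Φ Q) (hQ0 : Q ≠ 0) {k : ℝ}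
    (hk : (k : EReal) < lowerBohl Φ Q) :
    ∃ C : ℝ, ∀ x x' : ℝ, 0 ≤ x → x ≤ x' →
      ‖Φ x * (Φ x')⁻¹‖ ≤ C * Real.exp (k * (x - x')) := by
  have hk0 : k < 0 := by exact_mod_cast hk.trans_le (lowerBohl_le_zero hA hΦ hQ hQ0)
  obtain ⟨C, -, hC⟩ := exists_norm_le_of_lt_lowerBohl hk
  obtain ⟨-, -, k', -, C', -, hk', -, hC', -, h'⟩ := hQ
  refine ⟨C + C', fun x x' hx hxx' => ?_⟩
  have h1 : Φ x * (Φ x')⁻¹ = Φ x * Q * (Φ x')⁻¹ + Φ x * (1 - Q) * (Φ x')⁻¹ := by noncomm_ring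
  rw [h1, add_mul]
  refine (norm_add_le _ _).trans (add_le_add (hC x x' hx hxx') ((h' x x' hxx').trans ?_))
  refine mul_le_mul_of_nonneg_left (Real.exp_le_exp.2 ?_) (zero_le_one.trans hC')
  exact mul_le_mul_of_nonpos_right (hk0.trans hk').le (sub_nonpos.2 hxx')

/-- Real rates that realise the hypothesis on `β`. The room between `k` and `k₁` makes the growth
rate of a remainder `O(e^{k x})` strictly smaller than the lower Bohl exponent. -/
theorem exists_rates {β : ℝ} (hbot : lowerBohl Φ Q ≠ ⊥) (h0 : lowerBohl Φ Q ≤ 0)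
    (hβ : upperLyapunov Φ Q - lowerBohl Φ Q < (β : EReal)) :
    ∃ k k₁ l : ℝ, k < k₁ ∧ (k₁ : EReal) < lowerBohl Φ Q ∧ upperLyapunov Φ Q < (l : EReal) ∧
      l - k ≤ β := by
  lift lowerBohl Φ Q to ℝ using ⟨ne_top_of_le_ne_top EReal.zero_ne_top h0, hbot⟩ with κ
  rw [EReal.sub_lt_iff (Or.inl (EReal.coe_ne_bot _)) (Or.inl (EReal.coe_ne_top _)),
    ← EReal.coe_add] at hβ
  obtain ⟨l, hl, hlβ⟩ := EReal.lt_iff_exists_real_btwn.1 hβ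
  have hl' : l < β + κ := by exact_mod_cast hlβ
  refine ⟨l - β, (l - β + κ) / 2, l, by linarith, ?_, hl, by linarith⟩
  exact_mod_cast (by linarith : (l - β + κ) / 2 < κ)

end Exponents

/-! ### The weighted space and uniqueness -/

section Weighted

variable {d : ℕ} {R : ℝ → Mat d} {β : ℝ}

theorem integrableOn_exp_smul_of_weightedMeasure (hR : Integrable R (weightedMeasure β)) :
    IntegrableOn (fun t => Real.exp (β * t) • R t) (Ici 0) := by
  have h := (integrable_withDensity_iff_integrable_smul' (by fun_prop)
    (Eventually.of_forall fun x => ENNReal.ofReal_lt_top)).1 hR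
  simp only [ENNReal.toReal_ofReal (Real.exp_pos _).le] at h
  exact h

theorem integral_norm_weightedMeasure (R : ℝ → Mat d) :
    ∫ t, ‖R t‖ ∂weightedMeasure β = ∫ t in Ici 0, Real.exp (β * t) * ‖R t‖ := by
  rw [weightedMeasure, integral_withDensity_eq_integral_toReal_smul (by fun_prop)
    (Eventually.of_forall fun x => ENNReal.ofReal_lt_top)]
  simp only [ENNReal.toReal_ofReal (Real.exp_pos _).le, smul_eq_mul]

theorem integrableOn_exp_mul_norm_of_weightedMeasure (hR : Integrable R (weightedMeasure β)) :
    IntegrableOn (fun t => Real.exp (β * t) * ‖R t‖) (Ici 0) := by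
  refine (Integrable.norm (integrableOn_exp_smul_of_weightedMeasure hR)).congr
    (Eventually.of_forall fun t => ?_)
  simp only [norm_smul, Real.norm_of_nonneg (Real.exp_pos _).le]

theorem aestronglyMeasurable_of_integrable_weightedMeasure
    (hR : Integrable R (weightedMeasure β)) :
    AEStronglyMeasurable R (volume.restrict (Ici 0)) := by
  have h := (Continuous.aestronglyMeasurable (μ := volume.restrict (Ici (0 : ℝ)))
    (f := fun t : ℝ => Real.exp (-(β * t))) (by fun_prop)).smul
    (integrableOn_exp_smul_of_weightedMeasure hR).aestronglyMeasurable
  refine h.congr (Eventually.of_forall fun t => ?_)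
  change Real.exp (-(β * t)) • Real.exp (β * t) • R t = R t
  rw [smul_smul, ← Real.exp_add, neg_add_cancel, Real.exp_zero, one_smul]

/-- On `[0, ∞)`, a factor that grows at most like `e^{β x}` is absorbed by the weight. -/
theorem integrableOn_mul_of_weightedMeasure (hR : Integrable R (weightedMeasure β))
    {G : ℝ → Mat d} (hG : ContinuousOn G (Ici 0)) {C : ℝ}
    (hGC : ∀ t, 0 ≤ t → ‖G t‖ ≤ C * Real.exp (β * t)) :
    IntegrableOn (fun t => R t * G t) (Ici 0) := by
  refine Integrable.mono' ((integrableOn_exp_mul_norm_of_weightedMeasure hR).const_mul C)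
    ((aestronglyMeasurable_of_integrable_weightedMeasure hR).mul
      (hG.aestronglyMeasurable measurableSet_Ici))
    ((ae_restrict_iff' measurableSet_Ici).2 (Eventually.of_forall fun t ht => ?_))
  calc ‖R t * G t‖ ≤ ‖R t‖ * (C * Real.exp (β * t)) :=
        (norm_mul_le _ _).trans (mul_le_mul_of_nonneg_left (hGC t ht) (norm_nonneg _))
    _ = C * (Real.exp (β * t) * ‖R t‖) := by ring

theorem integrableOn_of_weightedMeasure (hβ : 0 ≤ β) (hR : Integrable R (weightedMeasure β)) :
    IntegrableOn R (Ici 0) := by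
  have h := integrableOn_mul_of_weightedMeasure hR (G := fun _ => 1) continuousOn_const
    (C := ‖(1 : Mat d)‖) fun t ht =>
      le_mul_of_one_le_right (norm_nonneg _) (Real.one_le_exp (mul_nonneg hβ ht))
  simpa only [mul_one] using h

end Weighted

section Uniqueness

variable {d : ℕ} {A Φ R D : ℝ → Mat d}

/-- A solution of the perturbed equation that grows more slowly than the rate `k` at which the
propagator decays backwards is determined by its equation: it vanishes. -/
theorem IsSolutionOn.eq_zero_of_norm_le (hA : LocallyIntegrable A volume)
    (hΦ : IsFundamentalSolution A Φ) {k k₁ C C₁ : ℝ}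
    (hC : ∀ x x' : ℝ, 0 ≤ x → x ≤ x' → ‖Φ x * (Φ x')⁻¹‖ ≤ C * Real.exp (k * (x - x')))
    (hR : IntegrableOn R (Ici 0)) (hD : IsSolutionOn (Ici 0) (fun x => A x + R x) D)
    (hk : k₁ < k) (hD₁ : ∀ x, 0 ≤ x → ‖D x‖ ≤ C₁ * Real.exp (k₁ * x)) :
    ∀ x, 0 ≤ x → D x = 0 := by
  have hC0 : 0 ≤ C := by
    have := (norm_nonneg _).trans (hC 0 0 le_rfl le_rfl)
    simpa using this
  have hC₁0 : 0 ≤ C₁ := by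
    have := (norm_nonneg _).trans (hD₁ 0 le_rfl)
    simpa using this
  -- scaling by `e^{-k x}` turns the kernel bound `C e^{k (x - t)} ‖R(t)‖` into `C ‖R(t)‖`
  set v : ℝ → ℝ := (Ici 0).indicator fun t => Real.exp (-(k * t)) * ‖D t‖
  set f : ℝ → ℝ := (Ici 0).indicator fun t => C * ‖R t‖
  have hf : Integrable f :=
    (integrable_indicator_iff measurableSet_Ici).2 ((Integrable.norm hR).const_mul C)
  have hf0 : ∀ t, 0 ≤ f t := fun t => indicator_nonneg (fun _ _ => by positivity) t
  have hv0 : ∀ t, 0 ≤ v t := fun t => indicator_nonneg (fun _ _ => by positivity) t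
  have hvle : ∀ t, 0 ≤ t → Real.exp (-(k * t)) * ‖D t‖ ≤ C₁ * Real.exp (-((k - k₁) * t)) :=
    fun t ht => by
      calc _ ≤ Real.exp (-(k * t)) * (C₁ * Real.exp (k₁ * t)) :=
            mul_le_mul_of_nonneg_left (hD₁ t ht) (Real.exp_pos _).le
        _ = C₁ * (Real.exp (-(k * t)) * Real.exp (k₁ * t)) := by ring
        _ = _ := by rw [← Real.exp_add]; ring_nf
  have hvC : ∀ t, 0 ≤ t → Real.exp (-(k * t)) * ‖D t‖ ≤ C₁ := fun t ht =>
    (hvle t ht).trans (mul_le_of_le_one_right hC₁0 (Real.exp_le_one_iff.2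
      (neg_nonpos.2 (mul_nonneg (sub_pos.2 hk).le ht))))
  have hvM : ∀ t, v t ≤ C₁ := fun t => indicator_le' (fun s hs => hvC s hs) (fun _ _ => hC₁0) t
  have hDcont := hD.continuousOn
  have hvm : AEStronglyMeasurable v volume := by
    refine (aestronglyMeasurable_indicator_iff measurableSet_Ici).2
      (ContinuousOn.aestronglyMeasurable ?_ measurableSet_Ici)
    exact ContinuousOn.mul (Continuous.continuousOn (by fun_prop)) hDcont.norm
  have hfv : Integrable fun t => f t * v t := hf.mul_bdd (c := C₁) hvm
    (Eventually.of_forall fun t => by rw [Real.norm_of_nonneg (hv0 t)]; exact hvM t)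
  have hv : ∀ x, v x ≤ 0 + ∫ t in Ioi x, f t * v t := fun x => by
    rw [zero_add]
    have hpos : ∀ s : Set ℝ, 0 ≤ ∫ t in s, f t * v t := fun s =>
      integral_nonneg fun t => mul_nonneg (hf0 t) (hv0 t)
    by_cases hx : x ∈ Ici (0 : ℝ)
    swap
    · simpa only [v, indicator_of_notMem hx] using hpos _
    have hx0 : 0 ≤ x := hx
    -- the boundary term of the variation of constants formula tends to `0`
    have ht : Tendsto (fun b : ℝ => C * (C₁ * Real.exp (-((k - k₁) * b))) +
        ∫ t in Ioi x, f t * v t) atTop (𝓝 (C * (C₁ * 0) + ∫ t in Ioi x, f t * v t)) :=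
      (((Real.tendsto_exp_neg_atTop_nhds_zero.comp
        (tendsto_id.const_mul_atTop (sub_pos.2 hk))).const_mul C₁).const_mul C).add_const _
    rw [mul_zero, mul_zero, zero_add] at ht
    refine ge_of_tendsto ht ((eventually_ge_atTop x).mono fun b hb => ?_)
    have hb0 : 0 ≤ b := hx0.trans hb
    have hsub : Icc x b ⊆ Ici 0 := fun t ht => hx0.trans ht.1
    have hint : IntegrableOn (fun t => (Φ t)⁻¹ * (R t * D t)) (Icc x b) := by
      obtain ⟨M₁, hM₁⟩ := isCompact_Icc.exists_bound_of_continuousOn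
        ((hΦ.continuousOn_inv hA).mono hsub)
      obtain ⟨M₂, hM₂⟩ := isCompact_Icc.exists_bound_of_continuousOn (hDcont.mono hsub)
      refine Integrable.bdd_mul (c := M₁) (Integrable.mul_bdd (c := M₂) (hR.mono_set hsub)
        ((hDcont.mono hsub).aestronglyMeasurable measurableSet_Icc)
        ((ae_restrict_iff' measurableSet_Icc).2 (Eventually.of_forall hM₂)))
        (((hΦ.continuousOn_inv hA).mono hsub).aestronglyMeasurable measurableSet_Icc)
        ((ae_restrict_iff' measurableSet_Icc).2 (Eventually.of_forall hM₁))
    have hformula := hΦ.inv_mul_sub_inv_mul_eq_integral hA hD hx0 hb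
      ((uIcc_of_le hb ▸ hint : IntegrableOn _ (uIcc x b)).intervalIntegrable)
    have hDx : D x = Φ x * (Φ b)⁻¹ * D b - ∫ t in Ioc x b, Φ x * ((Φ t)⁻¹ * (R t * D t)) := by
      rw [integral_const_mul_of_integrable (hint.mono_set Ioc_subset_Icc_self),
        ← intervalIntegral.integral_of_le hb, ← hformula, mul_sub, ← mul_assoc, ← mul_assoc,
        hΦ.mul_inv hA hx0, one_mul, sub_sub_cancel]
    have hE : Real.exp (-(k * x)) * Real.exp (k * x) = 1 := by
      rw [← Real.exp_add, neg_add_cancel, Real.exp_zero]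
    have hprop : ∀ t, x ≤ t → ∀ N : Mat d, ‖Φ x * ((Φ t)⁻¹ * N)‖ ≤
        Real.exp (k * x) * (C * (Real.exp (-(k * t)) * ‖N‖)) := fun t hxt N => by
      rw [← mul_assoc]
      calc _ ≤ C * Real.exp (k * (x - t)) * ‖N‖ :=
            (norm_mul_le _ _).trans (mul_le_mul_of_nonneg_right (hC x t hx0 hxt) (norm_nonneg _))
        _ = _ := by rw [mul_sub, sub_eq_add_neg, Real.exp_add]; ring
    have hI : ‖∫ t in Ioc x b, Φ x * ((Φ t)⁻¹ * (R t * D t))‖ ≤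
        Real.exp (k * x) * ∫ t in Ioi x, f t * v t := by
      calc _ ≤ ∫ t in Ioc x b, Real.exp (k * x) * (f t * v t) := by
            refine norm_integral_le_of_norm_le (hfv.const_mul _).integrableOn
              ((ae_restrict_iff' measurableSet_Ioc).2 (Eventually.of_forall fun t ht => ?_))
            have ht0 : t ∈ Ici (0 : ℝ) := hx0.trans ht.1.le
            simp only [f, v, indicator_of_mem ht0]
            refine (hprop t ht.1.le _).trans (mul_le_mul_of_nonneg_left ?_ (Real.exp_pos _).le)
            calc _ ≤ C * (Real.exp (-(k * t)) * (‖R t‖ * ‖D t‖)) :=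
                  mul_le_mul_of_nonneg_left (mul_le_mul_of_nonneg_left (norm_mul_le _ _)
                    (Real.exp_pos _).le) hC0
              _ = _ := by ring
        _ = Real.exp (k * x) * ∫ t in Ioc x b, f t * v t := integral_const_mul _ _
        _ ≤ _ := mul_le_mul_of_nonneg_left (setIntegral_mono_set hfv.integrableOn
            (Eventually.of_forall fun t => mul_nonneg (hf0 t) (hv0 t))
            Ioc_subset_Ioi_self.eventuallyLE) (Real.exp_pos _).le
    have hB : ‖Φ x * (Φ b)⁻¹ * D b‖ ≤
        Real.exp (k * x) * (C * (C₁ * Real.exp (-((k - k₁) * b)))) := by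
      rw [mul_assoc]
      exact (hprop b hb _).trans (mul_le_mul_of_nonneg_left
        (mul_le_mul_of_nonneg_left (hvle b hb0) hC0) (Real.exp_pos _).le)
    simp only [v, indicator_of_mem hx]
    calc Real.exp (-(k * x)) * ‖D x‖
        ≤ Real.exp (-(k * x)) * (Real.exp (k * x) * (C * (C₁ * Real.exp (-((k - k₁) * b)))) +
          Real.exp (k * x) * ∫ t in Ioi x, f t * v t) := by
          refine mul_le_mul_of_nonneg_left ?_ (Real.exp_pos _).le
          rw [hDx]
          exact (norm_sub_le _ _).trans (add_le_add hB hI)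
      _ = _ := by rw [← mul_add, ← mul_assoc, hE, one_mul]
  intro x hx
  have h := le_of_le_add_integral_Ioi hf hf0 le_rfl hv0 hvM hv x
  rw [mul_zero, zero_mul] at h
  simp only [v, indicator_of_mem (mem_Ici.2 hx)] at h
  exact norm_le_zero_iff.1 (nonpos_of_mul_nonpos_right h (Real.exp_pos _))

end Uniqueness

/-! ### The Volterra equation for Jost solutions -/

section Frame

variable {d : ℕ} {A Φ R R₀ V V₀ : ℝ → Mat d} {Q : Mat d} {k l C C₂ β : ℝ}

/-- The fundamental solution with the exponential `e^{k x}` divided out, extended to the negative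
half-line by its value at `0`. -/
noncomputable def scaledFrame (k : ℝ) (Φ : ℝ → Mat d) (x : ℝ) : Mat d :=
  Real.exp (-(k * max x 0)) • Φ (max x 0)

/-- The pointwise inverse of `scaledFrame k Φ`. -/
noncomputable def scaledFrameInv (k : ℝ) (Φ : ℝ → Mat d) (x : ℝ) : Mat d :=
  Real.exp (k * max x 0) • (Φ (max x 0))⁻¹

/-- The integrand of the Volterra equation for the scaled remainder
`V(x) = e^{-k x} (Y(x) - Φ(x) Q)` of a Jost solution `Y`. -/
noncomputable def jostIntegrand (k : ℝ) (Φ : ℝ → Mat d) (Q : Mat d) (R V : ℝ → Mat d) (t : ℝ) :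
    Mat d :=
  scaledFrameInv k Φ t * (Ici 0).indicator (fun t => R t * (V t + scaledFrame k Φ t * Q)) t

/-- `V` is a bounded continuous solution of the Volterra equation for the scaled remainder of a
Jost solution. -/
def IsJostRemainder (k : ℝ) (Φ : ℝ → Mat d) (Q : Mat d) (R V : ℝ → Mat d) : Prop :=
  Continuous V ∧ (∃ M, ∀ x, ‖V x‖ ≤ M) ∧
    ∀ x, V x = -(scaledFrame k Φ x * ∫ t in Ioi x, jostIntegrand k Φ Q R V t)

theorem continuous_scaledFrame (hΦ : IsFundamentalSolution A Φ) :
    Continuous (scaledFrame k Φ) := by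
  have h : Continuous fun x : ℝ => Φ (max x 0) :=
    hΦ.isSolutionOn_Ici.continuousOn.comp_continuous (by fun_prop) fun x => le_max_right x 0
  exact Continuous.smul (f := fun x : ℝ => Real.exp (-(k * max x 0))) (by fun_prop) h

theorem continuous_scaledFrameInv (hA : LocallyIntegrable A volume)
    (hΦ : IsFundamentalSolution A Φ) : Continuous (scaledFrameInv k Φ) := by
  have h : Continuous fun x : ℝ => (Φ (max x 0))⁻¹ :=
    (hΦ.continuousOn_inv hA).comp_continuous (by fun_prop) fun x => le_max_right x 0
  exact Continuous.smul (f := fun x : ℝ => Real.exp (k * max x 0)) (by fun_prop) h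

theorem norm_scaledFrame_mul_scaledFrameInv_le
    (hC : ∀ x x' : ℝ, 0 ≤ x → x ≤ x' → ‖Φ x * (Φ x')⁻¹‖ ≤ C * Real.exp (k * (x - x')))
    (x t : ℝ) (hxt : x ≤ t) : ‖scaledFrame k Φ x * scaledFrameInv k Φ t‖ ≤ C := by
  have hE : Real.exp (k * (max x 0 - max t 0)) =
      Real.exp (k * max x 0) * (Real.exp (k * max t 0))⁻¹ := by
    rw [mul_sub, sub_eq_add_neg, Real.exp_add, Real.exp_neg]
  have h := hC (max x 0) (max t 0) (le_max_right _ _) (max_le_max_right 0 hxt)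
  rw [scaledFrame, scaledFrameInv, smul_mul_smul_comm, norm_smul, Real.norm_of_nonneg
    (mul_nonneg (Real.exp_pos _).le (Real.exp_pos _).le), Real.exp_neg]
  rw [hE] at h
  have h1 := (Real.exp_pos (k * max x 0)).ne'
  have h2 := (Real.exp_pos (k * max t 0)).ne'
  calc _ ≤ (Real.exp (k * max x 0))⁻¹ * Real.exp (k * max t 0) *
        (C * (Real.exp (k * max x 0) * (Real.exp (k * max t 0))⁻¹)) :=
        mul_le_mul_of_nonneg_left h (by positivity)
    _ = C := by field_simp

/-- Left of `0` the scaled frame is the identity, so the bound on the product applies to the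
inverse alone. -/
theorem norm_scaledFrameInv_le (hΦ0 : Φ 0 = 1)
    (hC : ∀ x x' : ℝ, 0 ≤ x → x ≤ x' → ‖Φ x * (Φ x')⁻¹‖ ≤ C * Real.exp (k * (x - x')))
    (t : ℝ) : ‖scaledFrameInv k Φ t‖ ≤ C := by
  have h := norm_scaledFrame_mul_scaledFrameInv_le hC (min t 0) t (min_le_left _ _)
  have h1 : scaledFrame k Φ (min t 0) = 1 := by
    rw [scaledFrame, max_eq_right (min_le_right t 0), hΦ0, mul_zero, neg_zero, Real.exp_zero,
      one_smul]
  rwa [h1, one_mul] at h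

theorem norm_scaledFrame_mul_le (hC₂ : ∀ x, 0 ≤ x → ‖Φ x * Q‖ ≤ C₂ * Real.exp (l * x))
    (hlk : l - k ≤ β) (t : ℝ) (ht : 0 ≤ t) :
    ‖scaledFrame k Φ t * Q‖ ≤ C₂ * Real.exp (β * t) := by
  have hC₂0 : 0 ≤ C₂ := by
    have := (norm_nonneg _).trans (hC₂ 0 le_rfl)
    simpa using this
  rw [scaledFrame, max_eq_left ht, smul_mul_assoc, norm_smul,
    Real.norm_of_nonneg (Real.exp_pos _).le]
  calc _ ≤ Real.exp (-(k * t)) * (C₂ * Real.exp (l * t)) :=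
        mul_le_mul_of_nonneg_left (hC₂ t ht) (Real.exp_pos _).le
    _ = C₂ * (Real.exp (-(k * t)) * Real.exp (l * t)) := by ring
    _ = C₂ * Real.exp ((l - k) * t) := by rw [← Real.exp_add]; ring_nf
    _ ≤ _ := mul_le_mul_of_nonneg_left
        (Real.exp_le_exp.2 (mul_le_mul_of_nonneg_right hlk ht)) hC₂0

theorem integrable_scaledFrameInv_mul (hA : LocallyIntegrable A volume)
    (hΦ : IsFundamentalSolution A Φ)
    (hC : ∀ x x' : ℝ, 0 ≤ x → x ≤ x' → ‖Φ x * (Φ x')⁻¹‖ ≤ C * Real.exp (k * (x - x')))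
    {S : ℝ → Mat d} (hS : IntegrableOn S (Ici 0)) :
    Integrable fun t => scaledFrameInv k Φ t * (Ici 0).indicator S t :=
  ((integrable_indicator_iff measurableSet_Ici).2 hS).bdd_mul
    (continuous_scaledFrameInv hA hΦ).aestronglyMeasurable
    (Eventually.of_forall (norm_scaledFrameInv_le hΦ.2 hC))

theorem norm_add_scaledFrame_mul_le {M : ℝ} (hM : ∀ x, ‖V x‖ ≤ M) (hβ : 0 ≤ β)
    (hC₂ : ∀ x, 0 ≤ x → ‖Φ x * Q‖ ≤ C₂ * Real.exp (l * x)) (hlk : l - k ≤ β) (t : ℝ)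
    (ht : 0 ≤ t) : ‖V t + scaledFrame k Φ t * Q‖ ≤ (M + C₂) * Real.exp (β * t) := by
  rw [add_mul]
  refine (norm_add_le _ _).trans (add_le_add ((hM t).trans ?_)
    (norm_scaledFrame_mul_le hC₂ hlk t ht))
  exact le_mul_of_one_le_right ((norm_nonneg _).trans (hM t)) (Real.one_le_exp (mul_nonneg hβ ht))

theorem integrableOn_mul_add_scaledFrame_mul (hΦ : IsFundamentalSolution A Φ) (hβ : 0 ≤ β)
    (hC₂ : ∀ x, 0 ≤ x → ‖Φ x * Q‖ ≤ C₂ * Real.exp (l * x)) (hlk : l - k ≤ β)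
    (hR : Integrable R (weightedMeasure β)) (hV : Continuous V) {M : ℝ}
    (hM : ∀ x, ‖V x‖ ≤ M) :
    IntegrableOn (fun t => R t * (V t + scaledFrame k Φ t * Q)) (Ici 0) :=
  integrableOn_mul_of_weightedMeasure hR
    (hV.add ((continuous_scaledFrame hΦ).mul continuous_const)).continuousOn
    (norm_add_scaledFrame_mul_le hM hβ hC₂ hlk)

theorem exists_isJostRemainder (hA : LocallyIntegrable A volume)
    (hΦ : IsFundamentalSolution A Φ) (hβ : 0 ≤ β)
    (hC : ∀ x x' : ℝ, 0 ≤ x → x ≤ x' → ‖Φ x * (Φ x')⁻¹‖ ≤ C * Real.exp (k * (x - x')))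
    (hC₂ : ∀ x, 0 ≤ x → ‖Φ x * Q‖ ≤ C₂ * Real.exp (l * x)) (hlk : l - k ≤ β)
    (hR : Integrable R (weightedMeasure β)) : ∃ V, IsJostRemainder k Φ Q R V := by
  have hP := continuous_scaledFrame (k := k) hΦ
  have hR0 := integrableOn_of_weightedMeasure hβ hR
  have hS : IntegrableOn (fun t => R t * (scaledFrame k Φ t * Q)) (Ici 0) := by
    simpa only [zero_add] using integrableOn_mul_add_scaledFrame_mul (V := fun _ => 0) (M := 0) hΦ
      hβ hC₂ hlk hR continuous_const fun _ => norm_zero.le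
  have hG := integrable_scaledFrameInv_mul hA hΦ hC hS
  have hbound := norm_scaledFrame_mul_scaledFrameInv_le hC
  have hC0 : 0 ≤ C := (norm_nonneg _).trans (norm_scaledFrameInv_le hΦ.2 hC 0)
  have hSi := (integrable_indicator_iff measurableSet_Ici).2 hS
  obtain ⟨V, hV, ⟨M, hM⟩, hVeq⟩ := exists_volterra_solution hP (continuous_scaledFrameInv hA hΦ)
    (norm_scaledFrameInv_le hΦ.2 hC) hbound ((integrable_indicator_iff measurableSet_Ici).2 hR0)
    (h := fun x => -(scaledFrame k Φ x * ∫ t in Ioi x, scaledFrameInv k Φ t *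
      (Ici 0).indicator (fun t => R t * (scaledFrame k Φ t * Q)) t))
    (hP.mul (continuous_integral_Ioi hG)).neg
    (H := ∫ t, C * ‖(Ici 0).indicator (fun t => R t * (scaledFrame k Φ t * Q)) t‖)
    (fun x => by
      rw [norm_neg]
      exact (norm_mul_integral_Ioi_le hbound hG (hSi.norm.const_mul C) (fun t => le_rfl) x).trans
        (integral_Ioi_le_integral (hSi.norm.const_mul C)
          (fun t => mul_nonneg hC0 (norm_nonneg _)) x))
  refine ⟨V, hV, ⟨M, hM⟩, fun x => ?_⟩
  have hRV : Integrable fun t => scaledFrameInv k Φ t * ((Ici 0).indicator R t * V t) :=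
    integrable_mul_mul_of_bounded (continuous_scaledFrameInv hA hΦ)
      (norm_scaledFrameInv_le hΦ.2 hC) ((integrable_indicator_iff measurableSet_Ici).2 hR0) hV hM
  rw [hVeq x, ← neg_add', ← mul_add, ← integral_add hG.integrableOn hRV.integrableOn]
  congr 3
  ext1 t
  rw [jostIntegrand, ← mul_add]
  congr 1
  by_cases ht : t ∈ Ici (0 : ℝ)
  · simp only [indicator_of_mem ht]
    rw [← mul_add, add_comm]
  · simp only [indicator_of_notMem ht, zero_mul, add_zero]

theorem IsJostRemainder.isSolutionOn (hA : LocallyIntegrable A volume)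
    (hΦ : IsFundamentalSolution A Φ) (hβ : 0 ≤ β)
    (hC : ∀ x x' : ℝ, 0 ≤ x → x ≤ x' → ‖Φ x * (Φ x')⁻¹‖ ≤ C * Real.exp (k * (x - x')))
    (hC₂ : ∀ x, 0 ≤ x → ‖Φ x * Q‖ ≤ C₂ * Real.exp (l * x)) (hlk : l - k ≤ β)
    (hR : Integrable R (weightedMeasure β)) (hV : IsJostRemainder k Φ Q R V) :
    IsSolutionOn (Ici 0) (fun x => A x + R x) fun x => Φ x * Q + Real.exp (k * x) • V x := by
  obtain ⟨hVc, ⟨M, hM⟩, hVeq⟩ := hV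
  have hE : ∀ x, Real.exp (k * x) * Real.exp (-(k * x)) = 1 := fun x => by
    rw [← Real.exp_add, add_neg_cancel, Real.exp_zero]
  refine hΦ.isSolutionOn_mul_integral_Ioi hA (integrable_scaledFrameInv_mul hA hΦ hC
    (integrableOn_mul_add_scaledFrame_mul hΦ hβ hC₂ hlk hR hVc hM)) Q (fun x hx => ?_)
    fun x hx => ?_
  · rw [hVeq x, scaledFrame, max_eq_left hx, smul_neg, smul_mul_assoc, smul_smul, hE, one_smul,
      mul_sub, sub_eq_add_neg]
    rfl
  · rw [indicator_of_mem (mem_Ici.2 hx.le), scaledFrameInv, scaledFrame, max_eq_left hx.le,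
      smul_mul_assoc, smul_mul_assoc]
    simp only [mul_add, smul_add, mul_smul_comm, smul_smul, hE, one_smul]
    rw [add_comm]

theorem IsJostRemainder.expRate_lt (hV : IsJostRemainder k Φ Q R V) {k₁ : ℝ} (hk : k < k₁)
    (hk₁ : (k₁ : EReal) < lowerBohl Φ Q) :
    expRate (fun x => Φ x * Q + Real.exp (k * x) • V x - Φ x * Q) < lowerBohl Φ Q := by
  obtain ⟨-, ⟨M, hM⟩, -⟩ := hV
  refine (expRate_le_of_norm_le (C := M) hk fun x _ => ?_).trans_lt hk₁
  rw [add_sub_cancel_left, norm_smul, Real.norm_of_nonneg (Real.exp_pos _).le, mul_comm]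
  exact mul_le_mul_of_nonneg_right (hM x) (Real.exp_pos _).le

/-- Grönwall's inequality makes the remainder depend continuously on the perturbation. -/
theorem IsJostRemainder.norm_sub_le (hA : LocallyIntegrable A volume)
    (hΦ : IsFundamentalSolution A Φ) (hβ : 0 ≤ β)
    (hC : ∀ x x' : ℝ, 0 ≤ x → x ≤ x' → ‖Φ x * (Φ x')⁻¹‖ ≤ C * Real.exp (k * (x - x')))
    (hC₂ : ∀ x, 0 ≤ x → ‖Φ x * Q‖ ≤ C₂ * Real.exp (l * x)) (hlk : l - k ≤ β)
    (hR : Integrable R (weightedMeasure β)) (hR₀ : Integrable R₀ (weightedMeasure β))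
    (hV : IsJostRemainder k Φ Q R V) (hV₀ : IsJostRemainder k Φ Q R₀ V₀) {M : ℝ}
    (hM : ∀ x, ‖V₀ x‖ ≤ M) (x : ℝ) :
    ‖V x - V₀ x‖ ≤ 2 * (C * (M + C₂) * ∫ t, ‖R t - R₀ t‖ ∂weightedMeasure β) *
      Real.exp (2 * (C * ∫ t, ‖R t‖ ∂weightedMeasure β)) := by
  obtain ⟨hVc, ⟨M', hM'⟩, hVeq⟩ := hV
  obtain ⟨hV₀c, -, hV₀eq⟩ := hV₀
  have hC0 : 0 ≤ C := (norm_nonneg _).trans (norm_scaledFrameInv_le hΦ.2 hC 0)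
  have hM0 : 0 ≤ M := (norm_nonneg _).trans (hM 0)
  have hC₂0 : 0 ≤ C₂ := by
    have := (norm_nonneg _).trans (hC₂ 0 le_rfl)
    simpa using this
  have hRn := integrableOn_exp_mul_norm_of_weightedMeasure hR
  have hRd := integrableOn_exp_mul_norm_of_weightedMeasure (hR.sub hR₀)
  set f : ℝ → ℝ := (Ici 0).indicator fun t => C * (Real.exp (β * t) * ‖R t‖)
  set g : ℝ → ℝ := (Ici 0).indicator fun t =>
    C * (M + C₂) * (Real.exp (β * t) * ‖R t - R₀ t‖)
  have hf : Integrable f := (integrable_indicator_iff measurableSet_Ici).2 (hRn.const_mul C)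
  have hg : Integrable g :=
    (integrable_indicator_iff measurableSet_Ici).2 (hRd.const_mul (C * (M + C₂)))
  have hf0 : ∀ t, 0 ≤ f t := fun t => indicator_nonneg (fun _ _ => by positivity) t
  have hg0 : ∀ t, 0 ≤ g t := fun t => indicator_nonneg (fun _ _ => by positivity) t
  have hfint : ∫ t, f t = C * ∫ t, ‖R t‖ ∂weightedMeasure β := by
    rw [integral_indicator measurableSet_Ici, integral_const_mul, integral_norm_weightedMeasure]
  have hgint : ∫ t, g t = C * (M + C₂) * ∫ t, ‖R t - R₀ t‖ ∂weightedMeasure β := by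
    rw [integral_indicator measurableSet_Ici, integral_const_mul,
      integral_norm_weightedMeasure fun t => R t - R₀ t]
  have hvbd : ∀ t, ‖V t - V₀ t‖ ≤ M' + M := fun t =>
    (_root_.norm_sub_le _ _).trans (add_le_add (hM' t) (hM t))
  have hfv : Integrable fun t => f t * ‖V t - V₀ t‖ := hf.mul_bdd (c := M' + M)
    (hVc.sub hV₀c).norm.aestronglyMeasurable
    (Eventually.of_forall fun t => by rw [norm_norm]; exact hvbd t)
  have hS := integrableOn_mul_add_scaledFrame_mul hΦ hβ hC₂ hlk hR hVc hM'
  have hS₀ := integrableOn_mul_add_scaledFrame_mul hΦ hβ hC₂ hlk hR₀ hV₀c hM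
  have hJ : Integrable (jostIntegrand k Φ Q R V) := integrable_scaledFrameInv_mul hA hΦ hC hS
  have hJ₀ : Integrable (jostIntegrand k Φ Q R₀ V₀) := integrable_scaledFrameInv_mul hA hΦ hC hS₀
  have hkey : ∀ y, ‖V y - V₀ y‖ ≤ (∫ t, g t) + ∫ t in Ioi y, f t * ‖V t - V₀ t‖ := fun y => by
    have hsplit : V y - V₀ y = -(scaledFrame k Φ y * ∫ t in Ioi y, scaledFrameInv k Φ t *
        (Ici 0).indicator (fun t => R t * (V t + scaledFrame k Φ t * Q) -
          R₀ t * (V₀ t + scaledFrame k Φ t * Q)) t) := by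
      rw [hVeq y, hV₀eq y, sub_neg_eq_add, neg_add_eq_sub, ← neg_sub, ← mul_sub,
        ← integral_sub hJ.integrableOn hJ₀.integrableOn]
      congr 3
      ext1 t
      rw [jostIntegrand, jostIntegrand, ← mul_sub, indicator_sub]
    rw [hsplit, norm_neg]
    refine (norm_mul_integral_Ioi_le (norm_scaledFrame_mul_scaledFrameInv_le hC)
      (integrable_scaledFrameInv_mul hA hΦ hC (hS.sub hS₀)) (hg.add hfv) (fun t => ?_) y).trans ?_
    · by_cases ht : t ∈ Ici (0 : ℝ)
      swap
      · simp only [indicator_of_notMem ht, norm_zero, mul_zero, Pi.add_apply, f, g, zero_mul,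
          add_zero, le_refl]
      simp only [indicator_of_mem ht, Pi.add_apply, f, g]
      have h1 : R t * (V t + scaledFrame k Φ t * Q) - R₀ t * (V₀ t + scaledFrame k Φ t * Q) =
          (R t - R₀ t) * (V₀ t + scaledFrame k Φ t * Q) + R t * (V t - V₀ t) := by
        noncomm_ring
      have hexp : ‖R t‖ ≤ Real.exp (β * t) * ‖R t‖ :=
        le_mul_of_one_le_left (norm_nonneg _) (Real.one_le_exp (mul_nonneg hβ ht))
      rw [Pi.sub_apply, h1]
      calc _ ≤ C * (‖R t - R₀ t‖ * ((M + C₂) * Real.exp (β * t)) +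
            Real.exp (β * t) * ‖R t‖ * ‖V t - V₀ t‖) := by
            refine mul_le_mul_of_nonneg_left ((norm_add_le _ _).trans (add_le_add ?_ ?_)) hC0
            · exact (norm_mul_le _ _).trans (mul_le_mul_of_nonneg_left
                (norm_add_scaledFrame_mul_le hM hβ hC₂ hlk t ht) (norm_nonneg _))
            · exact (norm_mul_le _ _).trans (mul_le_mul_of_nonneg_right hexp (norm_nonneg _))
        _ = _ := by ring
    · simp only [Pi.add_apply]
      rw [integral_add hg.integrableOn hfv.integrableOn]
      exact add_le_add (integral_Ioi_le_integral hg hg0 y) le_rfl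
  rw [← hfint, ← hgint]
  refine (le_of_le_add_integral_Ioi hf hf0 (integral_nonneg hg0) (fun t => norm_nonneg _) hvbd
    hkey x).trans ?_
  refine mul_le_mul_of_nonneg_left (Real.exp_le_exp.2 ?_)
    (mul_nonneg zero_le_two (integral_nonneg hg0))
  exact mul_le_mul_of_nonneg_left (integral_Ioi_le_integral hf hf0 x) zero_le_two

/-- The rate `k` is chosen between the rates of both solutions and the lower Bohl exponent; no
uniformity over solutions is needed. -/
theorem IsJostSolution.eqOn (hA : LocallyIntegrable A volume) (hΦ : IsFundamentalSolution A Φ)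
    (hQ : IsExponentialDichotomy Φ Q) (hQ0 : Q ≠ 0) (hR : IntegrableOn R (Ici 0))
    {Y Z : ℝ → Mat d} (hY : IsJostSolution A Φ Q R Y) (hZ : IsJostSolution A Φ Q R Z) :
    EqOn Z Y (Ici 0) := by
  obtain ⟨k₁, hk₁, hk₁'⟩ := EReal.lt_iff_exists_real_btwn.1 (max_lt hY.2 hZ.2)
  obtain ⟨k, hkk, hk⟩ := EReal.lt_iff_exists_real_btwn.1 hk₁'
  obtain ⟨C, hC⟩ := exists_norm_propagator_le hA hΦ hQ hQ0 hk
  have hcont : ∀ {W : ℝ → Mat d}, IsSolutionOn (Ici 0) (fun x => A x + R x) W →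
      ContinuousOn (fun x => W x - Φ x * Q) (Ici 0) := fun hW =>
    hW.continuousOn.sub (hΦ.isSolutionOn_Ici.continuousOn.mul continuousOn_const)
  obtain ⟨C₁, hC₁⟩ :=
    exists_norm_le_of_expRate_lt (hcont hY.1) ((le_max_left _ _).trans_lt hk₁)
  obtain ⟨C₂, hC₂⟩ :=
    exists_norm_le_of_expRate_lt (hcont hZ.1) ((le_max_right _ _).trans_lt hk₁)
  intro x hx
  refine sub_eq_zero.1 ((hZ.1.sub hY.1).eq_zero_of_norm_le hA hΦ hC hR
    (EReal.coe_lt_coe_iff.1 hkk) (C₁ := C₂ + C₁) (fun t ht => ?_) x hx)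
  rw [← sub_sub_sub_cancel_right _ _ (Φ t * Q), add_mul]
  exact (_root_.norm_sub_le _ _).trans (add_le_add (hC₂ t ht) (hC₁ t ht))

end Frame

end MatrixJost

open MatrixJost
theorem mainTheorem7 (d : ℕ) (A Φ : ℝ → Mat d) (Q : Mat d)
    (hA : LocallyIntegrable A volume)
    (hΦ : IsFundamentalSolution A Φ)
    (hbdd : ExponentiallyBounded Φ)
    (hQ : IsExponentialDichotomy Φ Q)
    (hQ0 : Q ≠ 0)
    (β : ℝ) (hβ0 : 0 < β)
    (hβ : upperLyapunov Φ Q - lowerBohl Φ Q < (β : EReal)) :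
    (∀ R : ℝ → Mat d, Integrable R (weightedMeasure β) →
      ∃ Y : ℝ → Mat d, IsJostSolution A Φ Q R Y ∧
        ∀ Z : ℝ → Mat d, IsJostSolution A Φ Q R Z → EqOn Z Y (Ici 0)) ∧
    (∀ Y : Lp (Mat d) 1 (weightedMeasure β) → ℝ → Mat d,
      (∀ R : Lp (Mat d) 1 (weightedMeasure β), IsJostSolution A Φ Q R (Y R)) →
        Continuous (fun R => Y R 0)) := by
  obtain ⟨k, k₁, l, hk, hk₁, hl, hlk⟩ :=
    exists_rates (lowerBohl_ne_bot hA hΦ hbdd hQ) (lowerBohl_le_zero hA hΦ hQ hQ0) hβ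
  obtain ⟨C, hC⟩ := exists_norm_propagator_le hA hΦ hQ hQ0
    ((EReal.coe_lt_coe_iff.2 hk).trans hk₁)
  obtain ⟨C₂, hC₂⟩ := exists_norm_le_of_expRate_lt
    (hΦ.isSolutionOn_Ici.continuousOn.mul continuousOn_const) hl
  have hex : ∀ R : ℝ → Mat d, Integrable R (weightedMeasure β) →
      ∃ V, IsJostRemainder k Φ Q R V ∧
        IsJostSolution A Φ Q R fun x => Φ x * Q + Real.exp (k * x) • V x := fun R hR => by
    obtain ⟨V, hV⟩ := exists_isJostRemainder hA hΦ hβ0.le hC hC₂ hlk hR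
    exact ⟨V, hV, hV.isSolutionOn hA hΦ hβ0.le hC hC₂ hlk hR, hV.expRate_lt hk hk₁⟩
  have huniq : ∀ {R Y Z : ℝ → Mat d}, Integrable R (weightedMeasure β) →
      IsJostSolution A Φ Q R Y → IsJostSolution A Φ Q R Z → EqOn Z Y (Ici 0) := fun hR hY hZ =>
    hY.eqOn hA hΦ hQ hQ0 (integrableOn_of_weightedMeasure hβ0.le hR) hZ
  refine ⟨fun R hR => ?_, fun Y hY => ?_⟩
  · obtain ⟨V, -, hV⟩ := hex R hR
    exact ⟨_, hV, fun Z hZ => huniq hR hV hZ⟩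
  · have hint : ∀ R : Lp (Mat d) 1 (weightedMeasure β), Integrable R (weightedMeasure β) :=
      L1.integrable_coeFn
    -- a given Jost solution may approach the critical rate as `R` varies; by uniqueness it can be
    -- replaced by the constructed one, whose remainder is bounded at the fixed rate `k`
    choose V hV hVY using fun R : Lp (Mat d) 1 (weightedMeasure β) => hex R (hint R)
    have hY0 : ∀ R, Y R 0 = Q + V R 0 := fun R => by
      have h := huniq (hint R) (hVY R) (hY R) self_mem_Ici
      simp only [hΦ.2, one_mul, mul_zero, Real.exp_zero, one_smul] at h
      exact h
    refine continuous_iff_continuousAt.2 fun R₀ => ?_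
    obtain ⟨M, hM⟩ := (hV R₀).2.1
    have hle : ∀ R, dist (Y R 0) (Y R₀ 0) ≤
        2 * (C * (M + C₂) * ‖R - R₀‖) * Real.exp (2 * (C * ‖R‖)) := fun R => by
      have h := (hV R).norm_sub_le hA hΦ hβ0.le hC hC₂ hlk (hint R) (hint R₀) (hV R₀) hM 0
      have hn : ∫ t, ‖R t - R₀ t‖ ∂weightedMeasure β = ‖R - R₀‖ := by
        rw [L1.norm_eq_integral_norm]
        refine integral_congr_ae ?_
        filter_upwards [Lp.coeFn_sub R R₀] with t ht
        rw [ht, Pi.sub_apply]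
      rwa [hn, ← L1.norm_eq_integral_norm, ← add_sub_add_left_eq_sub _ _ Q, ← hY0, ← hY0,
        ← dist_eq_norm] at h
    have hcont : Continuous fun R : Lp (Mat d) 1 (weightedMeasure β) =>
        2 * (C * (M + C₂) * ‖R - R₀‖) * Real.exp (2 * (C * ‖R‖)) := by fun_prop
    have ht := hcont.tendsto R₀
    simp only [sub_self, norm_zero, mul_zero, zero_mul] at ht
    exact tendsto_iff_dist_tendsto_zero.2
      (squeeze_zero (fun _ => dist_nonneg) hle ht)
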